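/- Let $\hat f(z)=\sum_{p\ge 1}f_pz^p\in\mathbb C[[z]]$ be a formal power series without constant term, let $s\in\mathbb N=\{1,2,\dots\}$ and $k=1/s$. Denote by $\mathbb C\{z\}$ the convergent power series at $0$. For $d\in\mathbb R$ and $\theta,\rho>0$ let $S_d(\theta,\rho)=\{z:\ |\arg z-d|<\pi\theta/2,\ 0<|z|<\rho\}$ be the sector with bisecting direction $d$, opening $\pi\theta$ and radius $\rho$ on the Riemann surface of the logarithm. A holomorphic function $f$ on $S_d(\theta,\rho)$ with $\theta>1/k$ is a $k$-sum of $\hat f$ in direction $d$ if for every bounded sector $T$ with $\overline T\setminus\{0\}\subset S_d(\theta,\rho)$ there are $C,A>0$ such that $$\Big|f(z)-\sum_{p=0}^{N-1}f_pz^p\Big|\le C A^N N!^{1/k}|z|^N\qquad\text{for all } z\in T,\ N\ge 0;$$ $\hat f$ is $k$-summable in direction $d$ if such a sum exists on some such sector. The following statements are equivalent: (1) $\hat f$ is a formal solution of $P\big(z(z\partial_z+1)^s\big)y=g(z)$ for some polynomial $P\in\mathbb C[z]$ with $P(0)\ne 0$ and some $g\in\mathbb C\{z\}$. (2) There exist $r\in\mathbb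 N$, complex numbers $a_1,\dots,a_r$ and constants $C,M>0$ such that $$\Big|\frac{f_j}{j!^s}-\sum_{i=j-r}^{j-1}a_{j-i}\frac{f_i}{i!^s}\Big|\le\frac{CM^j}{j!^s}\qquad\text{for every } j>r.$$ (3) There exist $r\in\mathbb N$, complex numbers $a_1,\dots,a_r$, a polynomial $P\in\mathbb C[z]$ with $P(0)\ne0$ and some $g\in\mathbb C\{z\}$ such that, for every direction $d\in\mathbb R$ which is not (modulo $2\pi$) an argument of a root of $h(z)=1-a_1z-\dots-a_rz^r$, the series $\hat f$ is $k$-summable in direction $d$, and its $k$-sum $f$, on some sector $S_d$ bisected by $d$ and of opening larger than $\pi/k$ on whose projection $g$ converges, is a solution of $P\big(z(z\partial_z+1)^s\big)y=g(z)$. -/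

import Mathlib

open scoped PowerSeries Nat

noncomputable section

namespace GevreySum

/-- The Riemann surface of the logarithm in its global logarithmic chart: the complex number `w`
stands for the point `z` with modulus `|z| = exp (re w)` and argument `arg z = im w`. -/
abbrev LogSurface : Type := ℂ

namespace LogSurface

/-- The projection of a point of the surface to `ℂ ∖ {0}`. -/
def proj (w : LogSurface) : ℂ := Complex.exp w

/-- The modulus `|z|` of a point of the surface. -/
def abs (w : LogSurface) : ℝ := Real.exp w.re

/-- The argument of a point of the surface (a real number, not reduced modulo `2π`). -/
def arg (w : LogSurface) : ℝ := w.im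

end LogSurface

/-- The bounded sector `S_d(θ, ρ) = {z : |arg z - d| < π θ / 2, 0 < |z| < ρ}` with bisecting
direction `d`, opening `π θ` and radius `ρ`, on the Riemann surface of the logarithm. -/
def sector (d θ ρ : ℝ) : Set LogSurface :=
  {w | |w.arg - d| < Real.pi * θ / 2 ∧ w.abs < ρ}

/-- `F` admits `f` as its Gevrey asymptotic expansion of order `s` in `G`: on every bounded proper
subsector `T` of `G` there are `C, A > 0` with
`|F(z) - ∑_{p < N} f_p z^p| ≤ C A^N N!^s |z|^N` for all `N` and all `z ∈ T`.
The origin is not a point of the surface, so `closure T` is here what is written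
`closure T ∖ {0}` in the plane. -/
def HasGevreyExpansion (s : ℝ) (F : LogSurface → ℂ) (f : ℂ⟦X⟧) (G : Set LogSurface) : Prop :=
  ∀ d θ ρ : ℝ, 0 < θ → 0 < ρ → closure (sector d θ ρ) ⊆ G →
    ∃ C A : ℝ, 0 < C ∧ 0 < A ∧ ∀ N : ℕ, ∀ w ∈ sector d θ ρ,
      ‖F w - ∑ p ∈ Finset.range N, PowerSeries.coeff p f * w.proj ^ p‖ ≤
        C * A ^ N * (N ! : ℝ) ^ s * w.abs ^ N

/-- `F` is the `k`-sum of `f` in direction `d`, realized on the sector `S_d(θ, ρ)`: the opening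
`π θ` is larger than `π / k`, `F` is holomorphic on the sector and admits `f` there as its Gevrey
asymptotic expansion of order `1 / k`. The series `f` is `k`-summable in direction `d` when such
`θ`, `ρ`, `F` exist. -/
structure IsKSum (k : ℝ) (f : ℂ⟦X⟧) (d θ ρ : ℝ) (F : LogSurface → ℂ) : Prop where
  opening : 1 / k < θ
  radius_pos : 0 < ρ
  holomorphic : DifferentiableOn ℂ F (sector d θ ρ)
  expansion : HasGevreyExpansion (1 / k) F f (sector d θ ρ)

/-- The derivation `∂_z` on functions on the Riemann surface of the logarithm: in the coordinate
`w = log z` one has `∂_z = e^{-w} ∂_w`. -/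
def dz (F : LogSurface → ℂ) : LogSurface → ℂ := fun w => deriv F w / w.proj

/-- The operator `z ∂_z + 1` on functions. -/
def eulerAddOne (F : LogSurface → ℂ) : LogSurface → ℂ := fun w => w.proj * dz F w + F w

/-- The operator `z (z ∂_z + 1)^s` on functions. -/
def diffOp (s : ℕ) (F : LogSurface → ℂ) : LogSurface → ℂ :=
  fun w => w.proj * (eulerAddOne^[s] F) w

/-- The operator `P(z (z ∂_z + 1)^s)` on functions. -/
def polyDiffOp (s : ℕ) (P : Polynomial ℂ) (F : LogSurface → ℂ) : LogSurface → ℂ :=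
  fun w => P.sum fun m c => c * ((diffOp s)^[m] F) w

/-- The operator `z (z ∂_z + 1)^s` on formal power series. -/
def formalDiffOp (s : ℕ) : Module.End ℂ ℂ⟦X⟧ :=
  LinearMap.mulLeft ℂ (PowerSeries.X : ℂ⟦X⟧) *
    (LinearMap.mulLeft ℂ (PowerSeries.X : ℂ⟦X⟧) *
      (PowerSeries.derivative ℂ : Derivation ℂ ℂ⟦X⟧ ℂ⟦X⟧).toLinearMap + 1) ^ s

/-- `g ∈ ℂ{z}`: the power series `g` converges in a neighbourhood of the origin. -/
def IsConvergent (g : ℂ⟦X⟧) : Prop :=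
  ∃ R : ℝ, 0 < R ∧ ∀ z : ℂ, ‖z‖ < R → Summable fun n : ℕ => PowerSeries.coeff n g * z ^ n

/-- The polynomial `h(z) = 1 - a₁ z - ⋯ - a_r z^r`. -/
def recPoly (r : ℕ) (a : ℕ → ℂ) : Polynomial ℂ :=
  1 - ∑ i ∈ Finset.Icc 1 r, Polynomial.C (a i) * Polynomial.X ^ i

/-- `d` is not (modulo `2π`) the argument of a root of `h`. -/
def IsNonsingularDirection (h : Polynomial ℂ) (d : ℝ) : Prop :=
  ∀ z : ℂ, h.IsRoot z → (Complex.arg z : Real.Angle) ≠ (d : Real.Angle)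

/-- `f` is a formal solution of `P(z (z ∂_z + 1)^s) y = g` for some polynomial `P` with
`P(0) ≠ 0` and some `g ∈ ℂ{z}`. -/
def IsFormalSolution (s : ℕ) (f : ℂ⟦X⟧) : Prop :=
  ∃ (P : Polynomial ℂ) (g : ℂ⟦X⟧), P.eval 0 ≠ 0 ∧ IsConvergent g ∧
    Polynomial.aeval (formalDiffOp s) P f = g

/-- The recurrence estimate: for some `r ≥ 1`, `a₁, …, a_r ∈ ℂ` and `C, M > 0`,
`|f_j / j!^s - ∑_{i=j-r}^{j-1} a_{j-i} f_i / i!^s| ≤ C M^j / j!^s` for every `j > r`. -/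
def RecurrenceEstimate (s : ℕ) (f : ℂ⟦X⟧) : Prop :=
  ∃ (r : ℕ) (a : ℕ → ℂ) (C M : ℝ), 1 ≤ r ∧ 0 < C ∧ 0 < M ∧ ∀ j : ℕ, r < j →
    ‖PowerSeries.coeff j f / (j ! : ℂ) ^ s -
        ∑ i ∈ Finset.Ico (j - r) j, a (j - i) * (PowerSeries.coeff i f / (i ! : ℂ) ^ s)‖ ≤
      C * M ^ j / (j ! : ℝ) ^ s

/-- There are `h(z) = 1 - a₁ z - ⋯ - a_r z^r`, a polynomial `P` with `P(0) ≠ 0` and `g ∈ ℂ{z}`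
such that, in every direction `d` which is not the argument of a root of `h`, the series `f` is
`k`-summable and its `k`-sum `F`, on some sector bisected by `d` of opening larger than `π / k`,
solves `P(z (z ∂_z + 1)^s) y = g(z)`. -/
def SummableToSolution (k : ℝ) (s : ℕ) (f : ℂ⟦X⟧) : Prop :=
  ∃ (r : ℕ) (a : ℕ → ℂ) (P : Polynomial ℂ) (g : ℂ⟦X⟧),
    1 ≤ r ∧ P.eval 0 ≠ 0 ∧ IsConvergent g ∧
    ∀ d : ℝ, IsNonsingularDirection (recPoly r a) d →
      ∃ (θ ρ : ℝ) (F : LogSurface → ℂ), IsKSum k f d θ ρ F ∧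
        ∀ w ∈ sector d θ ρ,
          HasSum (fun n : ℕ => PowerSeries.coeff n g * w.proj ^ n) (polyDiffOp s P F w)

end GevreySum

end

noncomputable section

namespace GevreySum

open Complex MeasureTheory Filter Topology

/-! ### Integrals over horizontal lines -/

/-! Everything rests on the formal Borel transform `φ = ∑ f_j / j!^s ζ^j`. Since `(z ∂_z + 1)^s`
multiplies `z^j` by `(j+1)^s` and `(j+1)!^s = (j+1)^s j!^s`, the Borel transform turns `z (z ∂_z +
1)^s` into multiplication by `ζ` (`borel_formalDiffOp`, `borel_aeval`). The equation `P(z (z ∂_z +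
1)^s) f = g` thus becomes `P φ = γ`, with `γ` the Borel transform of `g`. After division by `P(0)`,
the `j`-th coefficient of this identity is the recurrence, and convergence of `g` is the bound `C
M^j / j!^s` on its right-hand side. This gives (1) ⇔ (2).

For (1) ⇒ (3), `γ` is entire of exponential growth of order `1/s`, so `φ = γ / P` continues along
each direction free of roots of `P`, to a thin sector where the growth is the same
(`HasExpansion.div_poly`). The sum is the `s`-fold iterate of the ordinary Laplace transform `L G(z)
= z⁻¹ ∫ e^{-ζ/z} G(ζ) dζ`. Each application multiplies the `p`-th coefficient by `p!`, widens the
sector by `π`, and lowers the order of growth from `1/(n+1)` to `1/n`; the last one, on functions of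
order one, converges only for small `|z|`. The identities `z (z ∂_z + 1) L G = L (ζ G)` and `(z ∂_z
+ 1) L G = L ((ζ ∂_ζ + 1) G)` combine to `z (z ∂_z + 1)^s L^s G = L^s (ζ G)`. Hence `P(z (z ∂_z +
1)^s) L^s φ = L^s γ`, and `L^s γ` is the sum of `g`.

For (3) ⇒ (1), a single nonsingular direction suffices. Asymptotic expansions may be differentiated,
so both `P(z (z ∂_z + 1)^s) f` and `g` are expansions of the same function; expansions are unique
(`eq_of_asymptotics`).

All analysis takes place in the chart `w = log z`, where sectors are strips, rays are horizontal
lines, and the Laplace transform is convolution with `e^{u - e^u}`. -/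

theorem integral_exp_mul_sub_exp (N : ℕ) {μ : ℝ} (hμ : 0 < μ) :
    Integrable (fun t : ℝ => Real.exp ((N + 1) * t - μ * Real.exp t)) ∧
      ∫ t : ℝ, Real.exp ((N + 1) * t - μ * Real.exp t) = N ! / μ ^ (N + 1) := by
  have himg : Real.exp '' Set.univ = Set.Ioi 0 := by rw [Set.image_univ, Real.range_exp]
  have hd : ∀ x ∈ (Set.univ : Set ℝ), HasDerivWithinAt Real.exp (Real.exp x) Set.univ x :=
    fun x _ => (Real.hasDerivAt_exp x).hasDerivWithinAt
  have hG := Real.integral_rpow_mul_exp_neg_mul_Ioi (a := N + 1) (r := μ) (by positivity) hμ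
  have hI : IntegrableOn (fun t : ℝ => t ^ ((N + 1 : ℝ) - 1) * Real.exp (-(μ * t))) (Set.Ioi 0) :=
    .of_integral_ne_zero (by rw [hG]; positivity)
  have heq : ∀ t : ℝ, |Real.exp t| • ((Real.exp t) ^ ((N + 1 : ℝ) - 1) *
      Real.exp (-(μ * Real.exp t))) = Real.exp ((N + 1) * t - μ * Real.exp t) := by
    intro t
    rw [abs_of_pos (Real.exp_pos t), add_sub_cancel_right, Real.rpow_natCast, smul_eq_mul,
      ← Real.exp_nat_mul, ← Real.exp_add, ← Real.exp_add]
    congr 1; ring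
  constructor
  · rw [← himg, integrableOn_image_iff_integrableOn_abs_deriv_smul MeasurableSet.univ hd
      Real.exp_injective.injOn] at hI
    simpa only [heq, integrableOn_univ] using hI
  · rw [← himg, integral_image_eq_integral_abs_deriv_smul MeasurableSet.univ hd
      Real.exp_injective.injOn] at hG
    simp only [heq, setIntegral_univ] at hG
    rw [hG, Real.Gamma_nat_eq_factorial, ← Nat.cast_succ, Real.rpow_natCast,
      one_div, inv_pow, div_eq_mul_inv, mul_comm]

/-- Shifting a horizontal line of integration inside a strip of holomorphy. -/
theorem integral_line_eq {K : ℂ → ℂ} {y₁ y₂ : ℝ}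
    (hK : DifferentiableOn ℂ K (Set.univ ×ℂ Set.uIcc y₁ y₂)) {B : ℝ → ℝ}
    (hB : ∀ t : ℝ, ∀ y ∈ Set.uIcc y₁ y₂, ‖K (t + y * I)‖ ≤ B t) (hint : Integrable B)
    (htop : Tendsto B atTop (𝓝 0)) (hbot : Tendsto B atBot (𝓝 0)) :
    ∫ t : ℝ, K (t + y₁ * I) = ∫ t : ℝ, K (t + y₂ * I) := by
  have hline : ∀ y ∈ Set.uIcc y₁ y₂, Integrable fun t : ℝ => K (t + y * I) := by
    intro y hy
    refine hint.mono' (Continuous.aestronglyMeasurable ?_) (Eventually.of_forall fun t => hB t y hy)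
    refine hK.continuousOn.comp_continuous (by fun_prop) fun t => ?_
    simpa [mem_reProdIm] using hy
  have hT : Tendsto (fun T : ℝ => -T) atTop atBot := tendsto_neg_atTop_atBot
  have h₁ := intervalIntegral_tendsto_integral (hline y₁ Set.left_mem_uIcc) hT tendsto_id
  have h₂ := intervalIntegral_tendsto_integral (hline y₂ Set.right_mem_uIcc) hT tendsto_id
  -- Cauchy's theorem on the rectangle with real parts in `[-T, T]`: the horizontal sides differ by
  -- the two vertical sides, which `B (T)` and `B (-T)` control.
  have hz : Tendsto (fun T : ℝ => (∫ t in -T..T, K (t + y₁ * I)) - ∫ t in -T..T, K (t + y₂ * I))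
      atTop (𝓝 0) := by
    have hb : Tendsto (fun T : ℝ => (B T + B (-T)) * |y₂ - y₁|) atTop (𝓝 0) := by
      simpa using (htop.add (hbot.comp hT)).mul_const |y₂ - y₁|
    refine squeeze_zero_norm (fun T => ?_) hb
    have hr := integral_boundary_rect_eq_zero_of_differentiableOn K ((-T : ℝ) + y₁ * I)
      (T + y₂ * I) (hK.mono fun z hz => by
        simp [mem_reProdIm] at hz ⊢; exact hz.2)
    simp only [add_re, ofReal_re, mul_re, I_re, mul_zero, ofReal_im, I_im, mul_one, sub_self,
      add_zero, add_im, mul_im, zero_add] at hr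
    have hv : ∀ S : ℝ, ‖∫ y : ℝ in y₁..y₂, K (S + y * I)‖ ≤ B S * |y₂ - y₁| := fun S =>
      intervalIntegral.norm_integral_le_of_norm_le_const fun y hy =>
        hB S y (Set.uIoc_subset_uIcc hy)
    have he : (∫ t in -T..T, K (t + y₁ * I)) - ∫ t in -T..T, K (t + y₂ * I) =
        I • (∫ y : ℝ in y₁..y₂, K ((-T : ℝ) + y * I)) -
          I • (∫ y : ℝ in y₁..y₂, K ((T : ℝ) + y * I)) := by linear_combination hr
    rw [he]
    refine (norm_sub_le _ _).trans ?_
    rw [norm_smul, norm_smul, norm_I, one_mul, one_mul]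
    linarith [hv T, hv (-T)]
  exact sub_eq_zero.1 (tendsto_nhds_unique (h₁.sub h₂) hz)

theorem tendsto_exp_mul_sub_exp (p : ℝ) (hp : 0 < p) {μ : ℝ} (hμ : 0 < μ) :
    Tendsto (fun t : ℝ => Real.exp (p * t - μ * Real.exp t)) atTop (𝓝 0) ∧
      Tendsto (fun t : ℝ => Real.exp (p * t - μ * Real.exp t)) atBot (𝓝 0) := by
  constructor
  · have h := (tendsto_rpow_mul_exp_neg_mul_atTop_nhds_zero p μ hμ).comp Real.tendsto_exp_atTop
    refine h.congr fun t => ?_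
    simp only [Function.comp]
    rw [← Real.exp_mul, ← Real.exp_add]; congr 1; ring
  · refine squeeze_zero (fun t => (Real.exp_pos _).le) (fun t => Real.exp_le_exp.2
      (show _ ≤ p * t by nlinarith [Real.exp_pos t])) ?_
    exact Real.tendsto_exp_atBot.comp (tendsto_id.const_mul_atBot hp)

/-! ### The Laplace kernel in the logarithmic chart -/

/-- The kernel `e^{-ζ} ζ`, where `ζ = e^u`. -/
def laplaceKernel (u : ℂ) : ℂ := cexp (u - cexp u)

theorem hasDerivAt_laplaceKernel (u : ℂ) :
    HasDerivAt laplaceKernel ((1 - cexp u) * laplaceKernel u) u := by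
  have := ((hasDerivAt_id u).sub (Complex.hasDerivAt_exp u)).cexp
  rw [mul_comm]
  exact this

theorem differentiable_laplaceKernel : Differentiable ℂ laplaceKernel :=
  fun u => (hasDerivAt_laplaceKernel u).differentiableAt

theorem continuous_laplaceKernel : Continuous laplaceKernel :=
  differentiable_laplaceKernel.continuous

theorem norm_laplaceKernel_le {u : ℂ} {ψ : ℝ} (hψ : ψ ≤ Real.pi) (hu : |u.im| ≤ ψ) :
    ‖laplaceKernel u‖ ≤ Real.exp (u.re - Real.cos ψ * Real.exp u.re) := by
  rw [laplaceKernel, Complex.norm_exp, sub_re, Complex.exp_re]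
  have : Real.cos ψ ≤ Real.cos u.im := by
    rw [← Real.cos_abs u.im]
    exact Real.cos_le_cos_of_nonneg_of_le_pi (abs_nonneg _) hψ hu
  refine Real.exp_le_exp.2 ?_
  nlinarith [Real.exp_pos u.re]

/-- The Laplace transform along the horizontal line `Im v = δ`. -/
def lineLaplace (δ : ℝ) (G : ℂ → ℂ) (w : ℂ) : ℂ :=
  ∫ t : ℝ, laplaceKernel (t + δ * I - w) * G (t + δ * I)

/-- The kernel decays like `e^{-2μ e^x}`. Half of this decay pays for the growth of `G`; the other
half keeps the integral convergent. -/
theorem norm_kernel_mul_le {G : ℂ → ℂ} {δ K μ ψ x : ℝ} {N : ℕ} {w : ℂ} {t : ℝ}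
    (hψ : ψ ≤ Real.pi) (hμ : 2 * μ = Real.cos ψ) (hδ : |δ - w.im| ≤ ψ) (hx : x = t - w.re)
    (hG : ‖G (t + δ * I)‖ ≤ K * Real.exp (N * t) * Real.exp (μ * Real.exp x)) :
    ‖laplaceKernel (t + δ * I - w) * G (t + δ * I)‖ ≤
      K * Real.exp (N * w.re) * Real.exp ((N + 1) * x - μ * Real.exp x) := by
  have hk := norm_laplaceKernel_le (u := t + δ * I - w) hψ (by simpa using hδ)
  simp only [sub_re, add_re, ofReal_re, mul_re, I_re, mul_zero, ofReal_im, I_im, mul_one, sub_self,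
    add_zero, ← hx, ← hμ] at hk
  rw [norm_mul]
  refine (mul_le_mul hk hG (norm_nonneg _) (Real.exp_pos _).le).trans (le_of_eq ?_)
  have : t = x + w.re := by linarith
  subst this
  rw [mul_assoc K, ← Real.exp_add, mul_left_comm, ← Real.exp_add, mul_assoc K, ← Real.exp_add]
  congr 2; ring

section Line

variable {G : ℂ → ℂ} {δ K μ ψ u : ℝ}

theorem lineLaplace_bound {N : ℕ} {w : ℂ} (hψ : ψ ≤ Real.pi) (hμ : 2 * μ = Real.cos ψ)
    (hμ0 : 0 < μ) (hδ : |δ - w.im| ≤ ψ) (hc : Continuous fun t : ℝ => G (t + δ * I))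
    (hG : ∀ t : ℝ, ‖G (t + δ * I)‖ ≤
      K * Real.exp (N * t) * Real.exp (μ * Real.exp (t - w.re))) :
    Integrable (fun t : ℝ => laplaceKernel (t + δ * I - w) * G (t + δ * I)) ∧
      ‖lineLaplace δ G w‖ ≤ K * Real.exp (N * w.re) * (N ! / μ ^ (N + 1)) := by
  obtain ⟨hi, hv⟩ := integral_exp_mul_sub_exp N hμ0
  have hi' := (hi.comp_sub_right w.re).const_mul (K * Real.exp (N * w.re))
  have hb := fun t : ℝ => norm_kernel_mul_le (x := t - w.re) hψ hμ hδ rfl (hG t)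
  refine ⟨hi'.mono' (Continuous.aestronglyMeasurable ?_) (Eventually.of_forall hb), ?_⟩
  · exact (continuous_laplaceKernel.comp (by fun_prop)).mul hc
  · refine (norm_integral_le_of_norm_le hi' (Eventually.of_forall hb)).trans (le_of_eq ?_)
    rw [integral_const_mul, ← hv]
    congr 1
    exact integral_sub_right_eq_self
      (fun t => Real.exp ((N + 1) * t - μ * Real.exp t)) w.re

/-- The Laplace transform does not depend on the admissible line. -/
theorem lineLaplace_eq_of_lines {N : ℕ} {δ' : ℝ} {w : ℂ} (hψ : ψ ≤ Real.pi)
    (hμ : 2 * μ = Real.cos ψ) (hμ0 : 0 < μ) (hδ : |δ - w.im| ≤ ψ) (hδ' : |δ' - w.im| ≤ ψ)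
    (hd : DifferentiableOn ℂ G (Set.univ ×ℂ Set.uIcc δ δ'))
    (hG : ∀ t : ℝ, ∀ y ∈ Set.uIcc δ δ', ‖G (t + y * I)‖ ≤
      K * Real.exp (N * t) * Real.exp (μ * Real.exp (t - w.re))) :
    lineLaplace δ G w = lineLaplace δ' G w := by
  obtain ⟨hi, -⟩ := integral_exp_mul_sub_exp N hμ0
  obtain ⟨h1, h2⟩ := tendsto_exp_mul_sub_exp (N + 1) (by positivity) hμ0
  refine integral_line_eq (K := fun v => laplaceKernel (v - w) * G v)
    (B := fun t => K * Real.exp (N * w.re) *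
      Real.exp ((N + 1) * (t - w.re) - μ * Real.exp (t - w.re))) ?_ ?_ ?_ ?_ ?_
  · exact ((differentiable_laplaceKernel.comp (by fun_prop)).differentiableOn).mul hd
  · intro t y hy
    refine norm_kernel_mul_le hψ hμ ?_ rfl (hG t y hy)
    have hy' : y - w.im ∈ Set.uIcc (δ - w.im) (δ' - w.im) := by
      simpa [Set.mem_uIcc] using hy
    rw [abs_le] at hδ hδ' ⊢
    exact Set.uIcc_subset_Icc (Set.mem_Icc.2 hδ) (Set.mem_Icc.2 hδ') hy'
  · exact (hi.comp_sub_right w.re).const_mul _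
  · simpa [← sub_eq_add_neg] using (h1.comp (tendsto_atTop_add_const_right _ (-w.re) tendsto_id)).const_mul
      (K * Real.exp (N * w.re))
  · simpa [← sub_eq_add_neg] using (h2.comp (tendsto_atBot_add_const_right _ (-w.re) tendsto_id)).const_mul
      (K * Real.exp (N * w.re))

/-- After moving the line to the height of `w`, the kernel is real and the integral is Euler's for
`N!`. -/
theorem lineLaplace_monomial {w : ℂ} (N : ℕ) (hδ : |δ - w.im| < Real.pi / 2) :
    lineLaplace δ (fun v => cexp v ^ N) w = N ! * cexp w ^ N := by
  have hcos : 0 < Real.cos |δ - w.im| :=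
    Real.cos_pos_of_mem_Ioo ⟨by linarith [abs_nonneg (δ - w.im), Real.pi_pos], hδ⟩
  have h := lineLaplace_eq_of_lines (G := fun v => cexp v ^ N) (K := 1) (N := N) (δ' := w.im)
    (w := w) (ψ := |δ - w.im|) (μ := Real.cos |δ - w.im| / 2) (δ := δ)
    (by linarith [Real.pi_pos]) (by ring) (by positivity) le_rfl (by simp)
    (Differentiable.differentiableOn (by fun_prop)) (fun t y _ => by
      rw [one_mul, ← Complex.exp_nat_mul, Complex.norm_exp]
      have : 0 ≤ Real.cos |δ - w.im| / 2 * Real.exp (t - w.re) := by positivity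
      simpa using le_mul_of_one_le_right (Real.exp_pos (N * t)).le (Real.one_le_exp this))
  rw [h]
  have he : ∀ t : ℝ, laplaceKernel (t + w.im * I - w) * cexp (t + w.im * I) ^ N =
      cexp w ^ N * (Real.exp ((N + 1) * (t - w.re) - 1 * Real.exp (t - w.re)) : ℝ) := by
    intro t
    have : (t + w.im * I - w : ℂ) = ((t - w.re : ℝ) : ℂ) := by
      apply Complex.ext <;> simp
    have h2 : (t + w.im * I : ℂ) = w + ((t - w.re : ℝ) : ℂ) := by rw [← this]; ring
    rw [this, h2, laplaceKernel, ← Complex.exp_nat_mul, ← Complex.exp_nat_mul, ofReal_exp,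
      ← Complex.exp_add, ← Complex.exp_add]
    congr 1; push_cast; ring
  rw [lineLaplace]
  simp_rw [he]
  rw [integral_const_mul, integral_complex_ofReal, integral_sub_right_eq_self
      (fun t => Real.exp ((N + 1) * t - 1 * Real.exp t)) w.re,
    (integral_exp_mul_sub_exp N one_pos).2]
  simp [mul_comm]

end Line

/-! ### Differentiation of the Laplace transform along a line -/

section Line

variable {G : ℂ → ℂ} {δ K μ ψ u : ℝ}

/-- A majorant independent of `w`, for dominated differentiation. Replacing `e^{t - Re w}` by `e^{t
- u}` costs a factor `e^ℓ` each time. -/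
theorem norm_kernel_deriv_mul_le {w : ℂ} {ℓ : ℝ} (hψ : ψ ≤ Real.pi) (hμ : 2 * μ = Real.cos ψ)
    (hμ0 : 0 < μ) (hδ : |δ - w.im| ≤ ψ) (hw : w.re ≤ u) (hℓ : u ≤ w.re + ℓ) (t : ℝ)
    (hG : ‖G (t + δ * I)‖ ≤ K * Real.exp (μ * Real.exp (t - u))) :
    ‖(cexp (t + δ * I - w) - 1) * (laplaceKernel (t + δ * I - w) * G (t + δ * I))‖ ≤
      K * Real.exp (2 * ℓ) * Real.exp ((1 + 1) * (t - u) - μ * Real.exp (t - u)) +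
      K * Real.exp ℓ * Real.exp ((0 + 1) * (t - u) - μ * Real.exp (t - u)) := by
  have hK : 0 ≤ K := by
    by_contra! h
    have := (norm_nonneg _).trans hG
    nlinarith [Real.exp_pos (μ * Real.exp (t - u))]
  have hx : t - u ≤ t - w.re := by linarith
  have hmono : μ * Real.exp (t - u) ≤ μ * Real.exp (t - w.re) := by gcongr
  have h1 := norm_kernel_mul_le (N := 0) (K := K) (x := t - w.re) hψ hμ hδ rfl (by
    simp only [CharP.cast_eq_zero, zero_mul, Real.exp_zero, mul_one]
    exact hG.trans (by gcongr))
  simp only [CharP.cast_eq_zero, zero_mul, Real.exp_zero, mul_one, zero_add, one_mul] at h1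
  have h2 : ‖cexp (t + δ * I - w) - 1‖ ≤ Real.exp (t - w.re) + 1 := by
    refine (norm_sub_le _ _).trans ?_
    rw [Complex.norm_exp]; simp
  rw [norm_mul]
  have h3 : Real.exp (t - w.re) ≤ Real.exp ℓ * Real.exp (t - u) := by
    rw [← Real.exp_add]; gcongr; linarith
  have h4 : Real.exp (t - w.re - μ * Real.exp (t - w.re)) ≤
      Real.exp ℓ * Real.exp (t - u - μ * Real.exp (t - u)) := by
    rw [← Real.exp_add]; gcongr; linarith
  calc _ ≤ (Real.exp ℓ * Real.exp (t - u) + 1) *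
        (K * (Real.exp ℓ * Real.exp (t - u - μ * Real.exp (t - u)))) := by
        refine mul_le_mul (h2.trans (by linarith)) (h1.trans (by gcongr)) (norm_nonneg _)
          (by positivity)
    _ = _ := by
        have e1 : Real.exp (2 * ℓ) = Real.exp ℓ * Real.exp ℓ := by rw [← Real.exp_add]; ring_nf
        have e2 : Real.exp ((1 + 1) * (t - u) - μ * Real.exp (t - u)) =
            Real.exp (t - u) * Real.exp (t - u - μ * Real.exp (t - u)) := by
          rw [← Real.exp_add]; ring_nf
        rw [e1, e2, zero_add, one_mul]; ring

theorem hasDerivAt_lineLaplace {w₀ : ℂ} (hψ : ψ ≤ Real.pi) (hμ : 2 * μ = Real.cos ψ)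
    (hμ0 : 0 < μ) (hδ : |δ - w₀.im| < ψ) (hu : w₀.re < u)
    (hc : Continuous fun t : ℝ => G (t + δ * I))
    (hG : ∀ t : ℝ, ‖G (t + δ * I)‖ ≤ K * Real.exp (μ * Real.exp (t - u))) :
    Integrable (fun t : ℝ =>
        (cexp (t + δ * I - w₀) - 1) * (laplaceKernel (t + δ * I - w₀) * G (t + δ * I))) ∧
      HasDerivAt (lineLaplace δ G) (∫ t : ℝ,
        (cexp (t + δ * I - w₀) - 1) * (laplaceKernel (t + δ * I - w₀) * G (t + δ * I))) w₀ := by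
  -- The lower bound on `Re w` allows `ℓ = u - Re w₀ + 1` in the majorant.
  have hs : {w : ℂ | |δ - w.im| < ψ ∧ w.re < u ∧ w₀.re - 1 < w.re} ∈ 𝓝 w₀ := by
    have ho : IsOpen {w : ℂ | |δ - w.im| < ψ ∧ w.re < u ∧ w₀.re - 1 < w.re} := by
      have hc : Continuous fun w : ℂ => |δ - w.im| := (continuous_const.sub continuous_im).abs
      exact (isOpen_lt hc continuous_const).inter ((isOpen_lt continuous_re continuous_const).inter
        (isOpen_lt continuous_const continuous_re))
    exact ho.mem_nhds ⟨hδ, hu, by linarith⟩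
  obtain ⟨i1, -⟩ := integral_exp_mul_sub_exp 1 hμ0
  obtain ⟨i0, -⟩ := integral_exp_mul_sub_exp 0 hμ0
  have hcont : ∀ w : ℂ, Continuous fun t : ℝ => laplaceKernel (t + δ * I - w) * G (t + δ * I) :=
    fun w => (continuous_laplaceKernel.comp (by fun_prop)).mul hc
  refine hasDerivAt_integral_of_dominated_loc_of_deriv_le hs
    (F := fun w t => laplaceKernel (t + δ * I - w) * G (t + δ * I))
    (F' := fun w t => (cexp (t + δ * I - w) - 1) * (laplaceKernel (t + δ * I - w) * G (t + δ * I)))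
    (bound := fun t => K * Real.exp (2 * (u - w₀.re + 1)) *
        Real.exp ((1 + 1) * (t - u) - μ * Real.exp (t - u)) +
      K * Real.exp (u - w₀.re + 1) * Real.exp ((0 + 1) * (t - u) - μ * Real.exp (t - u)))
    (Eventually.of_forall fun w => (hcont w).aestronglyMeasurable) ?_ ?_ ?_ ?_ ?_
  · have hK : 0 ≤ K := by
      by_contra! h
      have := (norm_nonneg _).trans (hG 0)
      nlinarith [Real.exp_pos (μ * Real.exp (0 - u))]
    refine (lineLaplace_bound (N := 0) (K := K) hψ hμ hμ0 hδ.le hc fun t => ?_).1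
    simp only [CharP.cast_eq_zero, zero_mul, Real.exp_zero, mul_one]
    exact (hG t).trans (by gcongr)
  · exact Continuous.aestronglyMeasurable (Continuous.mul (by fun_prop) (hcont w₀))
  · refine Eventually.of_forall fun t w hw => ?_
    exact norm_kernel_deriv_mul_le hψ hμ hμ0 hw.1.le hw.2.1.le (by linarith [hw.2.2]) t (hG t)
  · have := ((i1.comp_sub_right u).const_mul (K * Real.exp (2 * (u - w₀.re + 1)))).add
      ((i0.comp_sub_right u).const_mul (K * Real.exp (u - w₀.re + 1)))
    simp only [Nat.cast_one, CharP.cast_eq_zero] at this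
    exact this
  · refine Eventually.of_forall fun t w _ => ?_
    have h1 : HasDerivAt (fun w : ℂ => (t + δ * I - w : ℂ)) (-1) w := by
      simpa using (hasDerivAt_id w).const_sub (t + δ * I : ℂ)
    have h2 := ((hasDerivAt_laplaceKernel (t + δ * I - w)).comp w h1).mul_const (G (t + δ * I))
    refine h2.congr_deriv ?_
    ring

/-- The kernel depends on `v - w` only, so its `w`-derivative is minus its `v`-derivative, and
integration by parts moves it onto `G`. -/
theorem integral_kernel_deriv_eq {G' : ℂ → ℂ} {w : ℂ}
    (hd : ∀ t : ℝ, HasDerivAt G (G' (t + δ * I)) (t + δ * I))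
    (h₀ : Integrable fun t : ℝ => laplaceKernel (t + δ * I - w) * G (t + δ * I))
    (h₁ : Integrable fun t : ℝ =>
      (cexp (t + δ * I - w) - 1) * (laplaceKernel (t + δ * I - w) * G (t + δ * I)))
    (h₂ : Integrable fun t : ℝ => laplaceKernel (t + δ * I - w) * G' (t + δ * I)) :
    ∫ t : ℝ, (cexp (t + δ * I - w) - 1) * (laplaceKernel (t + δ * I - w) * G (t + δ * I)) =
      lineLaplace δ G' w := by
  have hline : ∀ t : ℝ, HasDerivAt (fun t : ℝ => (t + δ * I : ℂ)) 1 t := fun t =>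
    (Complex.ofRealCLM.hasDerivAt (x := t)).add_const _
  have key := integral_mul_deriv_eq_deriv_mul_of_integrable
    (u := fun t : ℝ => laplaceKernel (t + δ * I - w)) (v := fun t : ℝ => G (t + δ * I))
    (u' := fun t : ℝ => (1 - cexp (t + δ * I - w)) * laplaceKernel (t + δ * I - w))
    (v' := fun t : ℝ => G' (t + δ * I))
    (fun t _ => by
      have := (hasDerivAt_laplaceKernel (t + δ * I - w)).comp t ((hline t).sub_const w)
      simpa [Function.comp_def] using this)
    (fun t _ => by simpa [Function.comp_def] using (hd t).comp t (hline t))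
    h₂ (h₁.neg.congr (Eventually.of_forall fun t => by simp; ring)) h₀
  rw [lineLaplace, key, ← integral_neg]
  congr 1; ext t; ring

end Line

/-! ### The Laplace transform on strips -/

/-- The horizontal strip `|Im w - d| < a`, that is, the sector of infinite radius. -/
def strip (d a : ℝ) : Set ℂ := {w | |w.im - d| < a}

/-- The sector `|arg z - d| < b`, `|z| < exp R` in the logarithmic chart. -/
def logSector (d b R : ℝ) : Set ℂ := {w | |w.im - d| < b ∧ w.re < R}

theorem isOpen_strip (d a : ℝ) : IsOpen (strip d a) :=
  isOpen_lt (continuous_im.sub continuous_const).abs continuous_const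

theorem isOpen_logSector (d b R : ℝ) : IsOpen (logSector d b R) :=
  (isOpen_strip d b).inter (isOpen_lt continuous_re continuous_const)

/-- The line of integration used at the point `w`. -/
def laplaceLine (d a : ℝ) (w : ℂ) : ℝ := d + a / (a + Real.pi / 2) * (w.im - d)

/-- The Laplace transform of a function on the strip `|Im v - d| < a`, as a function on the
strip `|Im w - d| < a + π / 2`. -/
def laplace (d a : ℝ) (G : ℂ → ℂ) (w : ℂ) : ℂ := lineLaplace (laplaceLine d a w) G w

/-- A growth condition under which the Laplace transform converges on `logSector d b R`. -/
structure LaplaceBound (d a b R : ℝ) (G : ℂ → ℂ) : Prop where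
  differentiableOn : DifferentiableOn ℂ G (strip d a)
  bound : ∃ K : ℝ, ∀ v : ℂ, |v.im - d| ≤ a / (a + Real.pi / 2) * b → ‖G v‖ ≤
    K * Real.exp (Real.cos ((1 - a / (a + Real.pi / 2)) * b) / 2 * Real.exp (v.re - R))

theorem LaplaceBound.sub {d a b R : ℝ} {G H : ℂ → ℂ} (hG : LaplaceBound d a b R G)
    (hH : LaplaceBound d a b R H) : LaplaceBound d a b R (fun v => G v - H v) := by
  obtain ⟨K, hK⟩ := hG.bound
  obtain ⟨L, hL⟩ := hH.bound
  refine ⟨hG.1.sub hH.1, K + L, fun v hv => ?_⟩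
  rw [add_mul]
  exact (norm_sub_le _ _).trans (add_le_add (hK v hv) (hL v hv))

theorem eulerAddOne_apply (F : ℂ → ℂ) (w : ℂ) : eulerAddOne F w = deriv F w + F w := by
  rw [eulerAddOne, dz, LogSurface.proj, mul_div_cancel₀ _ (Complex.exp_ne_zero w)]

section Strip

variable {d a b R : ℝ} {G : ℂ → ℂ}

/-- The slope `a / (a + π/2)` of `laplaceLine` splits an angle below `a + π/2` into a part below
`a`, so that the line stays in the domain of `G`, and a part below `π/2`, where the kernel decays.
-/
theorem laplace_angle (ha : 0 < a) (hb : 0 < b) (hba : b < a + Real.pi / 2) :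
    0 < a / (a + Real.pi / 2) ∧ a / (a + Real.pi / 2) < 1 ∧ a / (a + Real.pi / 2) * b < a ∧
    0 < (1 - a / (a + Real.pi / 2)) * b ∧ (1 - a / (a + Real.pi / 2)) * b < Real.pi / 2 := by
  have hp := Real.pi_pos
  have hs : 0 < a + Real.pi / 2 := by positivity
  have h1 : a / (a + Real.pi / 2) < 1 := by rw [div_lt_one hs]; linarith
  have e : (1 - a / (a + Real.pi / 2)) = (Real.pi / 2) / (a + Real.pi / 2) := by field_simp; ring
  refine ⟨by positivity, h1, ?_, mul_pos (by linarith) hb, ?_⟩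
  · rw [div_mul_eq_mul_div, div_lt_iff₀ hs]; gcongr
  · rw [e, div_mul_eq_mul_div, div_lt_iff₀ hs]; gcongr

theorem laplace_cos_pos (ha : 0 < a) (hb : 0 < b) (hba : b < a + Real.pi / 2) :
    0 < Real.cos ((1 - a / (a + Real.pi / 2)) * b) / 2 := by
  obtain ⟨-, -, -, h1, h2⟩ := laplace_angle ha hb hba
  have := Real.cos_pos_of_mem_Ioo ⟨by linarith [Real.pi_pos], h2⟩
  positivity

theorem abs_laplaceLine_sub (ha : 0 < a) (hb : 0 < b) (hba : b < a + Real.pi / 2) {w : ℂ}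
    (hw : |w.im - d| < b) : |laplaceLine d a w - d| < a / (a + Real.pi / 2) * b ∧
      |laplaceLine d a w - w.im| < (1 - a / (a + Real.pi / 2)) * b := by
  obtain ⟨h0, h1, -⟩ := laplace_angle ha hb hba
  constructor
  · rw [laplaceLine, add_sub_cancel_left, abs_mul, abs_of_pos h0]; gcongr
  · have : laplaceLine d a w - w.im = -((1 - a / (a + Real.pi / 2)) * (w.im - d)) := by
      rw [laplaceLine]; ring
    rw [this, abs_neg, abs_mul, abs_of_pos (by linarith)]
    have : 0 < 1 - a / (a + Real.pi / 2) := by linarith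
    gcongr

theorem continuous_line (hG : DifferentiableOn ℂ G (strip d a)) {δ : ℝ} (hδ : |δ - d| < a) :
    Continuous fun t : ℝ => G (t + δ * I) :=
  hG.continuousOn.comp_continuous (by fun_prop) fun t => by simpa [strip] using hδ

theorem LaplaceBound.integrable (ha : 0 < a) (hb : 0 < b) (hba : b < a + Real.pi / 2)
    (hG : LaplaceBound d a b R G) {w : ℂ} (hw : w ∈ logSector d b R) :
    Integrable fun t : ℝ => laplaceKernel (t + laplaceLine d a w * I - w) *
      G (t + laplaceLine d a w * I) := by
  obtain ⟨K, hK⟩ := hG.bound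
  obtain ⟨h0, h1, h2, h3, h4⟩ := laplace_angle ha hb hba
  obtain ⟨l1, l2⟩ := abs_laplaceLine_sub ha hb hba hw.1
  have hμ := laplace_cos_pos ha hb hba
  have hK0 : 0 ≤ K := by
    by_contra! h
    have := (norm_nonneg _).trans (hK (laplaceLine d a w * I) (by simpa using l1.le))
    nlinarith [Real.exp_pos (Real.cos ((1 - a / (a + Real.pi / 2)) * b) / 2 *
      Real.exp ((laplaceLine d a w * I : ℂ).re - R))]
  refine (lineLaplace_bound (N := 0) (K := K) (by linarith [Real.pi_pos]) (by ring) hμ l2.le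
    (continuous_line hG.1 (l1.trans h2)) fun t => ?_).1
  refine (hK _ (by simpa using l1.le)).trans ?_
  have := hw.2
  simp only [CharP.cast_eq_zero, zero_mul, Real.exp_zero, mul_one, add_re, ofReal_re, mul_re, I_re,
    mul_zero, ofReal_im, I_im, sub_self, add_zero]
  gcongr

/-- The line in `laplace` moves with `w`. Near a given point it may be frozen, which makes
differentiation under the integral sign available. -/
theorem laplace_eventuallyEq (ha : 0 < a) (hb : 0 < b) (hba : b < a + Real.pi / 2)
    (hG : LaplaceBound d a b R G) {w₀ : ℂ} (hw : w₀ ∈ logSector d b R) :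
    laplace d a G =ᶠ[𝓝 w₀] lineLaplace (laplaceLine d a w₀) G := by
  obtain ⟨K, hK⟩ := hG.bound
  obtain ⟨h0, h1, h2, h3, h4⟩ := laplace_angle ha hb hba
  obtain ⟨l1, l2⟩ := abs_laplaceLine_sub ha hb hba hw.1
  have hμ := laplace_cos_pos ha hb hba
  have hK0 : 0 ≤ K := by
    by_contra! h
    have := (norm_nonneg _).trans (hK (laplaceLine d a w₀ * I) (by simpa using l1.le))
    nlinarith [Real.exp_pos (Real.cos ((1 - a / (a + Real.pi / 2)) * b) / 2 *
      Real.exp ((laplaceLine d a w₀ * I : ℂ).re - R))]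
  have hnear : ∀ᶠ w : ℂ in 𝓝 w₀, |laplaceLine d a w₀ - w.im| <
      (1 - a / (a + Real.pi / 2)) * b :=
    (isOpen_lt (continuous_const.sub continuous_im).abs continuous_const).mem_nhds l2
  filter_upwards [hnear, (isOpen_logSector d b R).mem_nhds hw] with w hw1 hw2
  obtain ⟨m1, m2⟩ := abs_laplaceLine_sub ha hb hba hw2.1
  have hmem : ∀ y ∈ Set.uIcc (laplaceLine d a w) (laplaceLine d a w₀),
      |y - d| < a / (a + Real.pi / 2) * b := by
    intro y hy
    have hy' : y - d ∈ Set.uIcc (laplaceLine d a w - d) (laplaceLine d a w₀ - d) := by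
      simpa [Set.mem_uIcc] using hy
    rw [abs_lt] at l1 m1 ⊢
    exact ((Set.ordConnected_Ioo).uIcc_subset m1 l1) hy'
  refine lineLaplace_eq_of_lines (N := 0) (K := K) (by linarith [Real.pi_pos]) (by ring) hμ m2.le
    hw1.le (hG.1.mono fun v hv => ?_) fun t y hy => ?_
  · exact (hmem v.im hv.2).trans h2
  · refine (hK _ (by simpa using (hmem y hy).le)).trans ?_
    have := hw2.2
    simp only [CharP.cast_eq_zero, zero_mul, Real.exp_zero, mul_one, add_re, ofReal_re, mul_re,
      I_re, mul_zero, ofReal_im, I_im, sub_self, add_zero]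
    gcongr

theorem LaplaceBound.hasDerivAt (ha : 0 < a) (hb : 0 < b) (hba : b < a + Real.pi / 2)
    (hG : LaplaceBound d a b R G) {w : ℂ} (hw : w ∈ logSector d b R) :
    Integrable (fun t : ℝ => (cexp (t + laplaceLine d a w * I - w) - 1) *
      (laplaceKernel (t + laplaceLine d a w * I - w) * G (t + laplaceLine d a w * I))) ∧
    HasDerivAt (laplace d a G) (∫ t : ℝ, (cexp (t + laplaceLine d a w * I - w) - 1) *
      (laplaceKernel (t + laplaceLine d a w * I - w) * G (t + laplaceLine d a w * I))) w := by
  obtain ⟨K, hK⟩ := hG.bound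
  obtain ⟨h0, h1, h2, h3, h4⟩ := laplace_angle ha hb hba
  obtain ⟨l1, l2⟩ := abs_laplaceLine_sub ha hb hba hw.1
  obtain ⟨i, D⟩ := hasDerivAt_lineLaplace (G := G) (K := K) (by linarith [Real.pi_pos])
    (by ring) (laplace_cos_pos ha hb hba) l2 hw.2 (continuous_line hG.1 (l1.trans h2)) fun t => by
      simpa using hK (t + laplaceLine d a w * I) (by simpa using l1.le)
  exact ⟨i, D.congr_of_eventuallyEq (laplace_eventuallyEq ha hb hba hG hw)⟩

theorem LaplaceBound.differentiableOn_laplace (ha : 0 < a) (hb : 0 < b)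
    (hba : b < a + Real.pi / 2) (hG : LaplaceBound d a b R G) :
    DifferentiableOn ℂ (laplace d a G) (logSector d b R) := fun _ hw =>
  (hG.hasDerivAt ha hb hba hw).2.differentiableAt.differentiableWithinAt

/-- Differentiating the kernel gives the factor `e^{v-w} - 1`. The summand `1` of the operator
cancels the `-1`, and `e^w e^{v-w} = e^v`. -/
theorem LaplaceBound.exp_mul_eulerAddOne (ha : 0 < a) (hb : 0 < b) (hba : b < a + Real.pi / 2)
    (hG : LaplaceBound d a b R G) {w : ℂ} (hw : w ∈ logSector d b R) :
    cexp w * eulerAddOne (laplace d a G) w = laplace d a (fun v => cexp v * G v) w := by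
  obtain ⟨i, D⟩ := hG.hasDerivAt ha hb hba hw
  have i' := hG.integrable ha hb hba hw
  rw [eulerAddOne_apply, D.deriv, laplace, lineLaplace, ← integral_add i i', laplace, lineLaplace,
    ← integral_const_mul]
  congr 1; ext t
  have : cexp (t + laplaceLine d a w * I) = cexp w * cexp (t + laplaceLine d a w * I - w) := by
    rw [← Complex.exp_add]; congr 1; ring
  rw [this]; ring

theorem LaplaceBound.eulerAddOne_laplace (ha : 0 < a) (hb : 0 < b) (hba : b < a + Real.pi / 2)
    (hG : LaplaceBound d a b R G) (hG' : LaplaceBound d a b R (eulerAddOne G)) {w : ℂ}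
    (hw : w ∈ logSector d b R) :
    eulerAddOne (laplace d a G) w = laplace d a (eulerAddOne G) w := by
  obtain ⟨i, D⟩ := hG.hasDerivAt ha hb hba hw
  have i' := hG.integrable ha hb hba hw
  obtain ⟨h0, h1, h2, h3, h4⟩ := laplace_angle ha hb hba
  obtain ⟨l1, l2⟩ := abs_laplaceLine_sub ha hb hba hw.1
  have hd : LaplaceBound d a b R (deriv G) := by
    have := hG'.sub hG
    simpa [eulerAddOne_apply] using this
  have i2 := hd.integrable ha hb hba hw
  have e : eulerAddOne G = fun v => deriv G v + G v := funext (eulerAddOne_apply G)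
  rw [eulerAddOne_apply, D.deriv, integral_kernel_deriv_eq (G' := deriv G) ?_ i' i i2, e]
  · simp only [laplace, lineLaplace]
    rw [← integral_add i2 i']
    congr 1; ext t; ring
  · intro t
    refine (hG.1.differentiableAt ((isOpen_strip d a).mem_nhds ?_)).hasDerivAt
    simpa [strip] using l1.trans h2

theorem laplace_sum (ha : 0 < a) (hb : 0 < b) (hba : b < a + Real.pi / 2) {ι : Type*}
    (S : Finset ι) (c : ι → ℂ) (H : ι → ℂ → ℂ) (hH : ∀ i ∈ S, LaplaceBound d a b R (H i))
    {w : ℂ} (hw : w ∈ logSector d b R) :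
    laplace d a (fun v => ∑ i ∈ S, c i * H i v) w = ∑ i ∈ S, c i * laplace d a (H i) w := by
  simp only [laplace, lineLaplace, Finset.mul_sum]
  rw [integral_finsetSum]
  · refine Finset.sum_congr rfl fun i _ => ?_
    rw [← integral_const_mul]
    congr 1; ext t; ring
  · intro i hi
    refine (((hH i hi).integrable ha hb hba hw).const_mul (c i)).congr
      (Eventually.of_forall fun t => ?_)
    simp only; ring

theorem laplace_congr (ha : 0 < a) {H : ℂ → ℂ} (hGH : Set.EqOn G H (strip d a)) {w : ℂ}
    (hw : w ∈ strip d (a + Real.pi / 2)) : laplace d a G w = laplace d a H w := by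
  have hp := Real.pi_pos
  have h : |laplaceLine d a w - d| < a := by
    rw [laplaceLine, add_sub_cancel_left, abs_mul, abs_of_pos (by positivity), div_mul_eq_mul_div,
      div_lt_iff₀ (by positivity)]
    have : |w.im - d| < a + Real.pi / 2 := hw
    gcongr
  simp only [laplace, lineLaplace]
  congr 1; ext t
  rw [hGH (show (t + laplaceLine d a w * I : ℂ) ∈ strip d a by simpa [strip] using h)]

end Strip

/-! ### Growth conditions on strips -/

/-- `G` is holomorphic on the strip and, on every smaller closed strip, of exponential growth of
order `1 / m` in the variable `e^w`. -/
def ExpGrowth (m : ℕ) (d a : ℝ) (G : ℂ → ℂ) : Prop :=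
  DifferentiableOn ℂ G (strip d a) ∧ ∀ b < a, ∃ c K : ℝ, 0 < c ∧ 0 < K ∧ ∀ w : ℂ,
    |w.im - d| ≤ b → ‖G w‖ ≤ K * Real.exp (c * Real.exp (w.re / m))

/-- `G` admits the asymptotic expansion `f` on the strip, with remainders governed by the
sequence `B` and with exponential growth of order `1 / m`. -/
def HasExpansion (B : ℕ → ℝ) (m : ℕ) (d a : ℝ) (f : ℂ⟦X⟧) (G : ℂ → ℂ) : Prop :=
  DifferentiableOn ℂ G (strip d a) ∧ ∀ b < a, ∃ c K A : ℝ, 0 < c ∧ 0 < K ∧ 0 < A ∧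
    ∀ (N : ℕ) (w : ℂ), |w.im - d| ≤ b →
      ‖G w - ∑ p ∈ Finset.range N, PowerSeries.coeff p f * cexp w ^ p‖ ≤
        K * A ^ N * B N * Real.exp (N * w.re) * Real.exp (c * Real.exp (w.re / m))

theorem im_re_le_of_mem_closedBall {d b ε : ℝ} {v w : ℂ} (hw : |w.im - d| ≤ b)
    (hv : v ∈ Metric.closedBall w ε) : |v.im - d| ≤ b + ε ∧ v.re ≤ w.re + ε := by
  rw [Metric.mem_closedBall, dist_eq_norm] at hv
  have h1 := (abs_im_le_norm (v - w)).trans hv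
  have h2 := (abs_re_le_norm (v - w)).trans hv
  rw [sub_im] at h1
  rw [sub_re] at h2
  constructor
  · calc |v.im - d| = |(v.im - w.im) + (w.im - d)| := by ring_nf
      _ ≤ _ := (abs_add_le _ _).trans (by linarith)
  · linarith [le_abs_self (v.re - w.re)]

theorem norm_deriv_le_of_strip {d a b ε C : ℝ} {G : ℂ → ℂ} (hG : DifferentiableOn ℂ G (strip d a))
    (hε : 0 < ε) (hb : b + ε < a) {w : ℂ} (hw : |w.im - d| ≤ b)
    (hC : ∀ v : ℂ, |v.im - d| ≤ b + ε → v.re ≤ w.re + ε → ‖G v‖ ≤ C) : ‖deriv G w‖ ≤ C / ε := by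
  refine Complex.norm_deriv_le_of_forall_mem_sphere_norm_le hε
    (hG.diffContOnCl_ball fun v hv => (im_re_le_of_mem_closedBall hw hv).1.trans_lt hb)
    fun v hv => ?_
  obtain ⟨h1, h2⟩ := im_re_le_of_mem_closedBall hw (Metric.sphere_subset_closedBall hv)
  exact hC v h1 h2

section Growth

variable {m : ℕ} {d a : ℝ} {G H : ℂ → ℂ}

theorem ExpGrowth.deriv (hG : ExpGrowth m d a G) : ExpGrowth m d a (deriv G) := by
  refine ⟨hG.1.deriv (isOpen_strip d a), fun b hb => ?_⟩
  have hε : 0 < (a - b) / 2 := by linarith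
  obtain ⟨c, K, hc, hK, h⟩ := hG.2 (b + (a - b) / 2) (by linarith)
  refine ⟨c * Real.exp ((a - b) / 2 / m), K / ((a - b) / 2), by positivity, by positivity,
    fun w hw => ?_⟩
  refine (norm_deriv_le_of_strip hG.1 hε (by linarith) hw
    (C := K * Real.exp (c * Real.exp ((w.re + (a - b) / 2) / m))) fun v h1 h2 => ?_).trans_eq ?_
  · refine (h v h1).trans ?_
    gcongr
  · rw [add_div, Real.exp_add]; ring_nf

theorem ExpGrowth.add (hG : ExpGrowth m d a G) (hH : ExpGrowth m d a H) :
    ExpGrowth m d a (fun w => G w + H w) := by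
  refine ⟨hG.1.add hH.1, fun b hb => ?_⟩
  obtain ⟨c, K, hc, hK, h⟩ := hG.2 b hb
  obtain ⟨c', K', hc', hK', h'⟩ := hH.2 b hb
  refine ⟨c + c', K + K', by positivity, by positivity, fun w hw => ?_⟩
  refine (norm_add_le _ _).trans ?_
  rw [add_mul]
  refine add_le_add ((h w hw).trans ?_) ((h' w hw).trans ?_)
  · gcongr; linarith
  · gcongr; linarith

theorem ExpGrowth.eulerAddOne (hG : ExpGrowth m d a G) : ExpGrowth m d a (eulerAddOne G) := by
  rw [show GevreySum.eulerAddOne G = fun w => _root_.deriv G w + G w from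
    funext (eulerAddOne_apply G)]
  exact hG.deriv.add hG

theorem ExpGrowth.eulerAddOne_iterate (hG : ExpGrowth m d a G) (n : ℕ) :
    ExpGrowth m d a (GevreySum.eulerAddOne^[n] G) := by
  induction n with
  | zero => exact hG
  | succ n ih => rw [Function.iterate_succ_apply']; exact ih.eulerAddOne

/-- One term of the exponential series at `e^{u/m}`. It shows that multiplication by `ζ` does not
raise the order of growth. -/
theorem exp_le_factorial_mul_exp (hm : m ≠ 0) (u : ℝ) :
    Real.exp u ≤ m ! * Real.exp (Real.exp (u / m)) := by
  have h := Real.pow_div_factorial_le_exp (Real.exp (u / m)) (Real.exp_pos _).le m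
  have hm' : (m : ℝ) ≠ 0 := by exact_mod_cast hm
  rw [← Real.exp_nat_mul, mul_div_cancel₀ u hm', div_le_iff₀ (by positivity)] at h
  linarith

theorem ExpGrowth.exp_mul (hm : m ≠ 0) (hG : ExpGrowth m d a G) :
    ExpGrowth m d a (fun w => cexp w * G w) := by
  refine ⟨Complex.differentiable_exp.differentiableOn.mul hG.1, fun b hb => ?_⟩
  obtain ⟨c, K, hc, hK, h⟩ := hG.2 b hb
  refine ⟨1 + c, m ! * K, by positivity, by positivity, fun w hw => ?_⟩
  rw [norm_mul, Complex.norm_exp, add_mul, one_mul, Real.exp_add]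
  refine (mul_le_mul (exp_le_factorial_mul_exp hm w.re) (h w hw) (norm_nonneg _)
    (by positivity)).trans_eq (by ring)

theorem HasExpansion.expGrowth {B : ℕ → ℝ} {f : ℂ⟦X⟧} (hB : 0 < B 0)
    (h : HasExpansion B m d a f G) : ExpGrowth m d a G := by
  refine ⟨h.1, fun b hb => ?_⟩
  obtain ⟨c, K, A, hc, hK, hA, h⟩ := h.2 b hb
  refine ⟨c, K * B 0, hc, by positivity, fun w hw => ?_⟩
  simpa using h 0 w hw

/-- A form of Young's inequality. -/
theorem exists_exp_div_le {n : ℕ} (hn : n ≠ 0) {c μ : ℝ} (hc : 0 < c) (hμ : 0 < μ) :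
    ∃ c' : ℝ, 0 < c' ∧ ∀ x u : ℝ,
      c * Real.exp ((x + u) / (n + 1 : ℕ)) ≤ μ * Real.exp x + c' * Real.exp (u / n) := by
  have hn0 : (0 : ℝ) < n := by exact_mod_cast Nat.pos_of_ne_zero hn
  set L := Real.log (c / μ) with hL
  have hexpL : Real.exp L = c / μ := Real.exp_log (by positivity)
  refine ⟨c * Real.exp (L / n), by positivity, fun x u => ?_⟩
  -- Convexity with weights `1/(n+1)` and `n/(n+1)`. The shift `L` is chosen so that `c e^{x-L} = μ
  -- e^x`.
  have hconv := (convexOn_iff_forall_pos.1 convexOn_exp).2 (Set.mem_univ (x - L))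
    (Set.mem_univ ((u + L) / n)) (show (0 : ℝ) < 1 / (n + 1) by positivity)
    (show (0 : ℝ) < n / (n + 1) by positivity) (by field_simp; ring)
  simp only [smul_eq_mul] at hconv
  have e : 1 / ((n : ℝ) + 1) * (x - L) + n / (n + 1) * ((u + L) / n) = (x + u) / (n + 1 : ℕ) := by
    push_cast; field_simp; ring
  rw [e] at hconv
  have h1 : 1 / ((n : ℝ) + 1) * Real.exp (x - L) ≤ 1 * Real.exp (x - L) := by
    gcongr
    rw [div_le_one (by positivity)]; linarith
  have h2 : (n : ℝ) / (n + 1) * Real.exp ((u + L) / n) ≤ 1 * Real.exp ((u + L) / n) := by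
    gcongr
    rw [div_le_one (by positivity)]; linarith
  rw [one_mul, Real.exp_sub, hexpL] at h1
  rw [one_mul, add_div, Real.exp_add] at h2
  calc c * Real.exp ((x + u) / (n + 1 : ℕ))
      ≤ c * (Real.exp x / (c / μ) + Real.exp (u / n) * Real.exp (L / n)) := by
        rw [add_div, Real.exp_add, Real.exp_sub, hexpL, add_div, Real.exp_add] at hconv
        gcongr
        rw [add_div, Real.exp_add]
        linarith
    _ = _ := by field_simp

/-- Growth of order below one is beaten by the kernel at every radius, by Young's inequality. -/
theorem ExpGrowth.laplaceBound {n : ℕ} (hn : n ≠ 0) (ha : 0 < a) (hG : ExpGrowth (n + 1) d a G)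
    {b : ℝ} (hb : 0 < b) (hba : b < a + Real.pi / 2) (R : ℝ) : LaplaceBound d a b R G := by
  obtain ⟨c, K, hc, hK, h⟩ := hG.2 _ (laplace_angle ha hb hba).2.2.1
  obtain ⟨c', hc', hy⟩ := exists_exp_div_le hn hc (laplace_cos_pos ha hb hba)
  refine ⟨hG.1, K * Real.exp (c' * Real.exp (R / n)), fun v hv => (h v hv).trans ?_⟩
  have := hy (v.re - R) R
  rw [sub_add_cancel] at this
  rw [mul_assoc, ← Real.exp_add]
  gcongr
  linarith

theorem exp_le_of_le_log {c μ R : ℝ} (hc : 0 < c) (hμ : 0 < μ) (hR : R ≤ Real.log (μ / c))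
    (x : ℝ) : c * Real.exp (x + R) ≤ μ * Real.exp x := by
  have : Real.exp R ≤ μ / c := (Real.le_log_iff_exp_le (by positivity)).1 hR
  rw [le_div_iff₀ hc] at this
  rw [Real.exp_add]
  nlinarith [Real.exp_pos x]

/-- At order one, growth and kernel decay compete on the same scale, so the radius must be small
compared with the growth constant. -/
theorem ExpGrowth.exists_laplaceBound (ha : 0 < a) (hG : ExpGrowth 1 d a G)
    {b : ℝ} (hb : 0 < b) (hba : b < a + Real.pi / 2) :
    ∃ R₀ : ℝ, ∀ R ≤ R₀, LaplaceBound d a b R G := by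
  obtain ⟨c, K, hc, hK, h⟩ := hG.2 _ (laplace_angle ha hb hba).2.2.1
  refine ⟨Real.log (Real.cos ((1 - a / (a + Real.pi / 2)) * b) / 2 / c),
    fun R hR => ⟨hG.1, K, fun v hv => (h v hv).trans ?_⟩⟩
  have := exp_le_of_le_log hc (laplace_cos_pos ha hb hba) hR (v.re - R)
  rw [sub_add_cancel] at this
  rw [Nat.cast_one, div_one]
  gcongr

/-- Since `ζ^p` has transform `p! z^p`, the remainder of the transform is the transform of the
remainder, to which the line estimate applies. The number `ω` collects the growth left after the
kernel has absorbed its share. -/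
theorem laplace_remainder_bound {b R : ℝ} (ha : 0 < a) (hb : 0 < b) (hba : b < a + Real.pi / 2)
    (hG : LaplaceBound d a b R G) {w : ℂ} (hw : w ∈ logSector d b R) {c K ω : ℝ} {f : ℂ⟦X⟧}
    (N : ℕ) (hK : 0 ≤ K) (h : ∀ v : ℂ, |v.im - d| ≤ a / (a + Real.pi / 2) * b →
      ‖G v - ∑ p ∈ Finset.range N, PowerSeries.coeff p f * cexp v ^ p‖ ≤
        K * Real.exp (N * v.re) * Real.exp (c * Real.exp (v.re / m)))
    (hω : ∀ x : ℝ, c * Real.exp ((x + w.re) / m) ≤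
      Real.cos ((1 - a / (a + Real.pi / 2)) * b) / 2 * Real.exp x + ω) :
    ‖laplace d a G w - ∑ p ∈ Finset.range N, (p ! * PowerSeries.coeff p f) * cexp w ^ p‖ ≤
      K * Real.exp ω * Real.exp (N * w.re) *
        (N ! / (Real.cos ((1 - a / (a + Real.pi / 2)) * b) / 2) ^ (N + 1)) := by
  obtain ⟨h0, h1, h2, h3, h4⟩ := laplace_angle ha hb hba
  obtain ⟨l1, l2⟩ := abs_laplaceLine_sub ha hb hba hw.1
  have hμ := laplace_cos_pos ha hb hba
  set δ := laplaceLine d a w with hδ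
  set μ := Real.cos ((1 - a / (a + Real.pi / 2)) * b) / 2 with hμdef
  have hψ : (1 - a / (a + Real.pi / 2)) * b ≤ Real.pi := by linarith [Real.pi_pos]
  have hmono : ∀ p : ℕ, Integrable fun t : ℝ =>
      laplaceKernel (t + δ * I - w) * cexp (t + δ * I) ^ p := fun p =>
    (lineLaplace_bound (G := fun v => cexp v ^ p) (N := p) (K := 1) hψ (by ring) hμ l2.le
      (by fun_prop) fun t => by
        rw [one_mul, ← Complex.exp_nat_mul, Complex.norm_exp]
        have : 0 ≤ μ * Real.exp (t - w.re) := by positivity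
        simpa using le_mul_of_one_le_right (Real.exp_pos (p * t)).le (Real.one_le_exp this)).1
  have hG' := hG.integrable ha hb hba hw
  have hlin : lineLaplace δ (fun v => G v - ∑ p ∈ Finset.range N,
      PowerSeries.coeff p f * cexp v ^ p) w =
      laplace d a G w - ∑ p ∈ Finset.range N, (p ! * PowerSeries.coeff p f) * cexp w ^ p := by
    have hs : ∀ p ∈ Finset.range N, Integrable fun t : ℝ => PowerSeries.coeff p f *
        (laplaceKernel (t + δ * I - w) * cexp (t + δ * I) ^ p) := fun p _ => (hmono p).const_mul _
    have e : ∀ t : ℝ, laplaceKernel (t + δ * I - w) * (G (t + δ * I) - ∑ p ∈ Finset.range N,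
        PowerSeries.coeff p f * cexp (t + δ * I) ^ p) =
        laplaceKernel (t + δ * I - w) * G (t + δ * I) - ∑ p ∈ Finset.range N,
        PowerSeries.coeff p f * (laplaceKernel (t + δ * I - w) * cexp (t + δ * I) ^ p) := by
      intro t
      rw [mul_sub, Finset.mul_sum]
      congr 1
      exact Finset.sum_congr rfl fun p _ => by ring
    simp only [lineLaplace, e]
    rw [integral_sub hG' (integrable_finsetSum _ hs), integral_finsetSum _ hs]
    congr 1
    refine Finset.sum_congr rfl fun p _ => ?_
    have := lineLaplace_monomial (w := w) p (l2.trans h4)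
    rw [integral_const_mul]
    simp only [lineLaplace] at this
    rw [this]; ring
  rw [← hlin]
  refine (lineLaplace_bound (N := N) (K := K * Real.exp ω) hψ (by ring) hμ l2.le ?_ fun t => ?_).2
  · exact (continuous_line hG.1 (l1.trans h2)).sub (by fun_prop)
  · refine (h _ (by simpa using l1.le)).trans ?_
    simp only [add_re, ofReal_re, mul_re, I_re, mul_zero, ofReal_im, I_im, mul_one, sub_self,
      add_zero]
    have := hω (t - w.re)
    rw [sub_add_cancel] at this
    calc _ ≤ K * Real.exp (N * t) * Real.exp (μ * Real.exp (t - w.re) + ω) := by gcongr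
      _ = _ := by rw [Real.exp_add]; ring

/-- Multiplication of the `p`-th coefficient by `p!`. -/
def factorialTransform (f : ℂ⟦X⟧) : ℂ⟦X⟧ := PowerSeries.mk fun p => p ! * PowerSeries.coeff p f

theorem exists_between_angle {b e : ℝ} (he : 0 < e) (hb : b < e) :
    ∃ b' : ℝ, 0 < b' ∧ b < b' ∧ b' < e := by
  obtain ⟨b', h1, h2⟩ := exists_between (max_lt he hb)
  exact ⟨b', (le_max_left _ _).trans_lt h1, (le_max_right _ _).trans_lt h1, h2⟩

theorem ExpGrowth.differentiableOn_laplace {n : ℕ} (hn : n ≠ 0) (ha : 0 < a)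
    (hG : ExpGrowth (n + 1) d a G) :
    DifferentiableOn ℂ (laplace d a G) (strip d (a + Real.pi / 2)) := by
  intro w hw
  obtain ⟨b, hb, hb1, hb2⟩ := exists_between_angle (by linarith [Real.pi_pos]) hw
  have := (hG.laplaceBound hn ha hb hb2 (w.re + 1)).hasDerivAt ha hb hb2 (w := w)
    ⟨hb1, by linarith⟩
  exact this.2.differentiableAt.differentiableWithinAt

theorem ExpGrowth.expGrowth_laplace {n : ℕ} (hn : n ≠ 0) (ha : 0 < a) (hG : ExpGrowth (n + 1) d a G) :
    ExpGrowth n d (a + Real.pi / 2) (laplace d a G) := by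
  refine ⟨hG.differentiableOn_laplace hn ha, fun b₀ hb₀ => ?_⟩
  obtain ⟨b, hb, hb1, hb2⟩ := exists_between_angle (by linarith [Real.pi_pos]) hb₀
  have hμ := laplace_cos_pos ha hb hb2
  obtain ⟨c, K, hc, hK, h⟩ := hG.2 _ (laplace_angle ha hb hb2).2.2.1
  obtain ⟨c', hc', hy⟩ := exists_exp_div_le hn hc hμ
  refine ⟨c', K / (Real.cos ((1 - a / (a + Real.pi / 2)) * b) / 2), hc', by positivity,
    fun w hw => ?_⟩
  -- With `f = 0` and `N = 0` the remainder is the function itself. Every radius is admissible here,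
  -- so `Re w + 1` serves.
  have := laplace_remainder_bound (f := 0) (m := n + 1) ha hb hb2
    (hG.laplaceBound hn ha hb hb2 (w.re + 1)) (w := w) ⟨hw.trans_lt hb1, by linarith⟩ 0 hK.le
    (c := c) (ω := c' * Real.exp (w.re / n)) (by simpa using h) (fun x => hy x w.re)
  refine this.trans_eq' (by simp) |>.trans_eq ?_
  simp; ring

theorem HasExpansion.hasExpansion_laplace {n : ℕ} (hn : n ≠ 0) (ha : 0 < a) {B : ℕ → ℝ} (hB : ∀ N, 0 < B N)
    {f : ℂ⟦X⟧} (hG : HasExpansion B (n + 1) d a f G) :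
    HasExpansion (fun N => B N * N !) n d (a + Real.pi / 2) (factorialTransform f)
      (laplace d a G) := by
  have hG0 := hG.expGrowth (hB 0)
  refine ⟨hG0.differentiableOn_laplace hn ha, fun b₀ hb₀ => ?_⟩
  obtain ⟨b, hb, hb1, hb2⟩ := exists_between_angle (by linarith [Real.pi_pos]) hb₀
  have hμ := laplace_cos_pos ha hb hb2
  obtain ⟨c, K, A, hc, hK, hA, h⟩ := hG.2 _ (laplace_angle ha hb hb2).2.2.1
  obtain ⟨c', hc', hy⟩ := exists_exp_div_le hn hc hμ
  refine ⟨c', K / (Real.cos ((1 - a / (a + Real.pi / 2)) * b) / 2),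
    A / (Real.cos ((1 - a / (a + Real.pi / 2)) * b) / 2), hc', by positivity, by positivity,
    fun N w hw => ?_⟩
  have hBN := hB N
  have := laplace_remainder_bound (f := f) (m := n + 1) ha hb hb2
    (hG0.laplaceBound hn ha hb hb2 (w.re + 1)) (w := w) ⟨hw.trans_lt hb1, by linarith⟩ N
    (K := K * A ^ N * B N) (by positivity) (c := c) (ω := c' * Real.exp (w.re / n)) (h N)
    (fun x => hy x w.re)
  simp only [factorialTransform, PowerSeries.coeff_mk]
  refine this.trans_eq ?_
  generalize Real.cos ((1 - a / (a + Real.pi / 2)) * b) / 2 = μ at hμ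
  rw [div_pow, pow_succ]
  field_simp

theorem HasExpansion.exists_laplace_bound (ha : 0 < a) {B : ℕ → ℝ} (hB : ∀ N, 0 < B N)
    {f : ℂ⟦X⟧} (hG : HasExpansion B 1 d a f G) {b : ℝ} (hb : 0 < b) (hba : b < a + Real.pi / 2) :
    ∃ R₀ K A : ℝ, 0 < K ∧ 0 < A ∧ ∀ (N : ℕ), ∀ w ∈ logSector d b R₀,
      ‖laplace d a G w - ∑ p ∈ Finset.range N,
        PowerSeries.coeff p (factorialTransform f) * cexp w ^ p‖ ≤
        K * A ^ N * (B N * N !) * Real.exp (N * w.re) := by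
  have hG0 := hG.expGrowth (hB 0)
  have hμ := laplace_cos_pos ha hb hba
  obtain ⟨R₁, hR₁⟩ := hG0.exists_laplaceBound ha hb hba
  obtain ⟨c, K, A, hc, hK, hA, h⟩ := hG.2 _ (laplace_angle ha hb hba).2.2.1
  refine ⟨min R₁ (Real.log (Real.cos ((1 - a / (a + Real.pi / 2)) * b) / 2 / c)),
    K / (Real.cos ((1 - a / (a + Real.pi / 2)) * b) / 2),
    A / (Real.cos ((1 - a / (a + Real.pi / 2)) * b) / 2), by positivity, by positivity,
    fun N w hw => ?_⟩
  have hBN := hB N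
  have := laplace_remainder_bound (f := f) (m := 1) ha hb hba
    (hR₁ _ (min_le_left _ _)) hw N
    (K := K * A ^ N * B N) (by positivity) (c := c) (ω := 0) (h N)
    (fun x => by
      rw [Nat.cast_one, div_one, add_zero]
      exact exp_le_of_le_log hc hμ (hw.2.le.trans (min_le_right _ _)) x)
  simp only [factorialTransform, PowerSeries.coeff_mk]
  refine this.trans_eq ?_
  generalize Real.cos ((1 - a / (a + Real.pi / 2)) * b) / 2 = μ at hμ
  rw [div_pow, pow_succ, Real.exp_zero]
  field_simp

end Growth

/-! ### Differential operators and congruence on open sets -/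

theorem eqOn_eulerAddOne {U : Set ℂ} (hU : IsOpen U) {F G : ℂ → ℂ} (h : Set.EqOn F G U) :
    Set.EqOn (eulerAddOne F) (eulerAddOne G) U := by
  intro w hw
  have : F =ᶠ[𝓝 w] G := Filter.eventuallyEq_of_mem (hU.mem_nhds hw) h
  rw [eulerAddOne_apply, eulerAddOne_apply, this.deriv_eq, h hw]

theorem eqOn_eulerAddOne_iterate {U : Set ℂ} (hU : IsOpen U) {F G : ℂ → ℂ} (h : Set.EqOn F G U)
    (n : ℕ) : Set.EqOn (eulerAddOne^[n] F) (eulerAddOne^[n] G) U := by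
  induction n with
  | zero => exact h
  | succ n ih =>
    rw [Function.iterate_succ_apply', Function.iterate_succ_apply']
    exact eqOn_eulerAddOne hU ih

theorem eqOn_diffOp {U : Set ℂ} (hU : IsOpen U) {F G : ℂ → ℂ} (h : Set.EqOn F G U) (s : ℕ) :
    Set.EqOn (diffOp s F) (diffOp s G) U := fun w hw => by
  rw [diffOp, diffOp, eqOn_eulerAddOne_iterate hU h s hw]

section Laplace

variable {d a b R : ℝ}

theorem eqOn_eulerAddOne_iterate_laplace (ha : 0 < a) (hb : 0 < b) (hba : b < a + Real.pi / 2)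
    {K : ℂ → ℂ} {n : ℕ} (hK : ∀ i ≤ n, LaplaceBound d a b R (eulerAddOne^[i] K)) :
    Set.EqOn (eulerAddOne^[n] (laplace d a K)) (laplace d a (eulerAddOne^[n] K))
      (logSector d b R) := by
  induction n with
  | zero => exact fun _ _ => rfl
  | succ n ih =>
    intro w hw
    have h1 := eqOn_eulerAddOne (isOpen_logSector d b R) (ih fun i hi => hK i (by omega)) hw
    have h2 := hK (n + 1) le_rfl
    rw [Function.iterate_succ_apply'] at h2 ⊢
    rw [h1, (hK n (by omega)).eulerAddOne_laplace ha hb hba h2 hw, Function.iterate_succ_apply']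

/-- Of the `n + 1` Euler factors, `n` commute with the Laplace transform; the last one together with
`z` becomes multiplication by `ζ`. -/
theorem diffOp_laplace (ha : 0 < a) (hb : 0 < b) (hba : b < a + Real.pi / 2)
    {K : ℂ → ℂ} {n : ℕ} (hK : ∀ i ≤ n, LaplaceBound d a b R (eulerAddOne^[i] K)) {w : ℂ}
    (hw : w ∈ logSector d b R) :
    diffOp (n + 1) (laplace d a K) w = laplace d a (diffOp n K) w := by
  have h1 := eqOn_eulerAddOne (isOpen_logSector d b R)
    (eqOn_eulerAddOne_iterate_laplace ha hb hba hK) hw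
  rw [diffOp, Function.iterate_succ_apply', h1]
  exact (hK n le_rfl).exp_mul_eulerAddOne ha hb hba hw

end Laplace

/-! ### Iterated Laplace transforms -/

/-- The `n`-fold Laplace transform of a function on the strip `|Im v - d| < a`, as a function on
the strip `|Im w - d| < a + n π / 2`. -/
def laplaceIter (d a : ℝ) : ℕ → (ℂ → ℂ) → ℂ → ℂ
  | 0, G => G
  | n + 1, G => laplace d (a + n * (Real.pi / 2)) (laplaceIter d a n G)

section Iter

variable {d a : ℝ}

theorem add_succ_mul_pi (a : ℝ) (n : ℕ) :
    a + (n + 1 : ℕ) * (Real.pi / 2) = a + n * (Real.pi / 2) + Real.pi / 2 := by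
  push_cast; ring

/-- The index `k` counts the growth budget left after `n` transforms. While `k ≠ 0` the result lives
on a full strip; the last transform is treated separately, on a sector of finite radius. -/
theorem ExpGrowth.laplaceIter (ha : 0 < a) {G : ℂ → ℂ} (n : ℕ) {k : ℕ} (hk : k ≠ 0)
    (hG : ExpGrowth (n + k) d a G) :
    ExpGrowth k d (a + n * (Real.pi / 2)) (laplaceIter d a n G) := by
  induction n generalizing k with
  | zero => simpa [GevreySum.laplaceIter] using hG
  | succ n ih =>
    rw [add_succ_mul_pi]
    exact (ih (Nat.succ_ne_zero k) (by rwa [Nat.succ_add_eq_add_succ] at hG)).expGrowth_laplace hk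
      (by positivity)

theorem HasExpansion.laplaceIter (ha : 0 < a) {B : ℕ → ℝ} (hB : ∀ N, 0 < B N) {f : ℂ⟦X⟧}
    {G : ℂ → ℂ} (n : ℕ) {k : ℕ} (hk : k ≠ 0) (hG : HasExpansion B (n + k) d a f G) :
    HasExpansion (fun N => B N * (N ! : ℝ) ^ n) k d (a + n * (Real.pi / 2))
      (factorialTransform^[n] f) (laplaceIter d a n G) := by
  induction n generalizing k with
  | zero => simpa [GevreySum.laplaceIter] using hG
  | succ n ih =>
    rw [add_succ_mul_pi, Function.iterate_succ_apply']
    have := (ih (Nat.succ_ne_zero k)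
      (by rwa [Nat.succ_add_eq_add_succ] at hG)).hasExpansion_laplace hk (by positivity)
      fun N => mul_pos (hB N) (by positivity)
    simpa only [pow_succ, mul_assoc] using! this

theorem diffOp_laplaceIter (ha : 0 < a) {G : ℂ → ℂ} (n : ℕ) {k : ℕ} (hk : k ≠ 0)
    (hG : ExpGrowth (n + k) d a G) :
    Set.EqOn (diffOp n (laplaceIter d a n G)) (laplaceIter d a n fun v => cexp v * G v)
      (strip d (a + n * (Real.pi / 2))) := by
  induction n generalizing k with
  | zero => exact fun _ _ => rfl
  | succ n ih =>
    intro w hw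
    rw [Nat.succ_add_eq_add_succ] at hG
    rw [add_succ_mul_pi] at hw
    have ha' : 0 < a + n * (Real.pi / 2) := by positivity
    have hK := hG.laplaceIter ha n (Nat.succ_ne_zero k)
    obtain ⟨b, hb, hb1, hb2⟩ := exists_between_angle (by positivity) hw
    have h := diffOp_laplace ha' hb hb2 (n := n)
      (fun i _ => (hK.eulerAddOne_iterate i).laplaceBound hk ha' hb hb2 (w.re + 1)) (w := w)
      ⟨hb1, by linarith⟩
    exact h.trans (laplace_congr ha' (ih (Nat.succ_ne_zero k) hG) hw)

theorem exists_diffOp_laplaceIter (ha : 0 < a) {G : ℂ → ℂ} (n : ℕ)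
    (hG : ExpGrowth (n + 1) d a G) {b : ℝ} (hb : 0 < b)
    (hba : b < a + (n + 1 : ℕ) * (Real.pi / 2)) :
    ∃ R₀ : ℝ, Set.EqOn (diffOp (n + 1) (laplaceIter d a (n + 1) G))
      (laplaceIter d a (n + 1) fun v => cexp v * G v) (logSector d b R₀) := by
  rw [add_succ_mul_pi] at hba
  have ha' : 0 < a + n * (Real.pi / 2) := by positivity
  have hK := hG.laplaceIter ha n one_ne_zero
  choose R hR using fun i => (hK.eulerAddOne_iterate i).exists_laplaceBound ha' hb hba
  obtain ⟨R₀, hR₀⟩ := ((Finset.range (n + 1)).image R).bddBelow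
  refine ⟨R₀, fun w hw => ?_⟩
  have h := diffOp_laplace ha' hb hba (n := n)
    (fun i hi => hR i R₀ (hR₀ (Finset.mem_image_of_mem R (Finset.mem_range.2 (by omega))))) hw
  exact h.trans (laplace_congr ha' (diffOp_laplaceIter ha n one_ne_zero hG) (hw.1.trans hba))

theorem laplaceIter_sum (ha : 0 < a) (n : ℕ) {k : ℕ} (hk : k ≠ 0) {ι : Type*} (S : Finset ι)
    (c : ι → ℂ) (H : ι → ℂ → ℂ) (hH : ∀ i ∈ S, ExpGrowth (n + k) d a (H i)) :
    Set.EqOn (laplaceIter d a n fun v => ∑ i ∈ S, c i * H i v)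
      (fun w => ∑ i ∈ S, c i * laplaceIter d a n (H i) w) (strip d (a + n * (Real.pi / 2))) := by
  induction n generalizing k with
  | zero => exact fun _ _ => rfl
  | succ n ih =>
    intro w hw
    have hH' : ∀ i ∈ S, ExpGrowth (n + (k + 1)) d a (H i) := fun i hi => by
      have := hH i hi
      rwa [Nat.succ_add_eq_add_succ] at this
    rw [add_succ_mul_pi] at hw
    have ha' : 0 < a + n * (Real.pi / 2) := by positivity
    obtain ⟨b, hb, hb1, hb2⟩ := exists_between_angle (by positivity) hw
    refine (laplace_congr ha' (ih (Nat.succ_ne_zero k) hH') hw).trans ?_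
    exact laplace_sum ha' hb hb2 (R := w.re + 1) S c _ (fun i hi =>
      ((hH' i hi).laplaceIter ha n (Nat.succ_ne_zero k)).laplaceBound hk ha' hb hb2 _)
      ⟨hb1, by linarith⟩

theorem exists_laplaceIter_sum (ha : 0 < a) (n : ℕ) {ι : Type*} (S : Finset ι)
    (c : ι → ℂ) (H : ι → ℂ → ℂ) (hH : ∀ i, ExpGrowth (n + 1) d a (H i)) {b : ℝ} (hb : 0 < b)
    (hba : b < a + (n + 1 : ℕ) * (Real.pi / 2)) :
    ∃ R₀ : ℝ, Set.EqOn (laplaceIter d a (n + 1) fun v => ∑ i ∈ S, c i * H i v)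
      (fun w => ∑ i ∈ S, c i * laplaceIter d a (n + 1) (H i) w) (logSector d b R₀) := by
  classical
  rw [add_succ_mul_pi] at hba
  have ha' : 0 < a + n * (Real.pi / 2) := by positivity
  choose R hR using fun i => ((hH i).laplaceIter ha n one_ne_zero).exists_laplaceBound ha' hb hba
  obtain ⟨R₀, hR₀⟩ := (S.image R).bddBelow
  refine ⟨R₀, fun w hw => ?_⟩
  refine (laplace_congr ha' (laplaceIter_sum ha n one_ne_zero S c H fun i _ => hH i)
    (hw.1.trans hba)).trans ?_
  exact laplace_sum ha' hb hba S c _ (fun i hi =>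
    hR i R₀ (hR₀ (Finset.mem_image_of_mem R hi))) hw

theorem ExpGrowth.exp_pow_mul {m : ℕ} (hm : m ≠ 0) {G : ℂ → ℂ} (hG : ExpGrowth m d a G) (i : ℕ) :
    ExpGrowth m d a fun v => cexp v ^ i * G v := by
  induction i with
  | zero => simpa using hG
  | succ i ih =>
    have := ih.exp_mul hm
    simpa only [pow_succ', mul_assoc] using this

/-- The iterated Laplace transform turns multiplication by `P(ζ)` into `P(z (z ∂_z + 1)^s)`. -/
theorem exists_polyDiffOp_laplaceIter (ha : 0 < a) {s : ℕ} (hs : 1 ≤ s) {G : ℂ → ℂ}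
    (hG : ExpGrowth s d a G) (P : Polynomial ℂ) {b : ℝ} (hb : 0 < b)
    (hba : b < a + s * (Real.pi / 2)) :
    ∃ R₀ : ℝ, Set.EqOn (polyDiffOp s P (laplaceIter d a s G))
      (laplaceIter d a s fun v => P.eval (cexp v) * G v) (logSector d b R₀) := by
  obtain ⟨n, rfl⟩ : ∃ n, s = n + 1 := ⟨s - 1, by omega⟩
  have hG' := fun i => hG.exp_pow_mul (Nat.succ_ne_zero n) i
  choose R hR using fun i => exists_diffOp_laplaceIter ha n (hG' i) hb hba
  obtain ⟨R₁, hR₁⟩ := exists_laplaceIter_sum ha n P.support P.coeff _ hG' hb hba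
  -- Each power of the operator has its own radius, and only finitely many occur in `P`.
  obtain ⟨R₂, hR₂⟩ := ((Finset.range (P.natDegree + 1)).image R).bddBelow
  have hmono : ∀ {R R' : ℝ}, R ≤ R' → logSector d b R ⊆ logSector d b R' :=
    fun h w hw => ⟨hw.1, hw.2.trans_le h⟩
  have hiter : ∀ i ≤ P.natDegree, Set.EqOn ((diffOp (n + 1))^[i] (laplaceIter d a (n + 1) G))
      (laplaceIter d a (n + 1) fun v => cexp v ^ i * G v) (logSector d b R₂) := by
    intro i
    induction i with
    | zero => intro _ w _; simp
    | succ i ih =>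
      intro hi w hw
      rw [Function.iterate_succ_apply', eqOn_diffOp (isOpen_logSector d b R₂) (ih (by omega)) _ hw,
        hR i (hmono (hR₂ (Finset.mem_image_of_mem R (Finset.mem_range.2 (by omega)))) hw)]
      simp only [pow_succ', mul_assoc]
  refine ⟨min R₁ R₂, fun w hw => ?_⟩
  have h1 := hR₁ (hmono (min_le_left _ _) hw)
  have e : (fun v => P.eval (cexp v) * G v) =
      fun v => ∑ i ∈ P.support, P.coeff i * (cexp v ^ i * G v) := by
    ext v
    rw [Polynomial.eval_eq_sum, Polynomial.sum, Finset.sum_mul]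
    exact Finset.sum_congr rfl fun i _ => by ring
  rw [e, h1, polyDiffOp, Polynomial.sum]
  refine Finset.sum_congr rfl fun i hi => ?_
  rw [hiter i (Polynomial.le_natDegree_of_mem_supp i hi) (hmono (min_le_right _ _) hw)]

end Iter

/-! ### The formal Borel transform -/

/-- The formal Borel transform `∑ f_j z^j ↦ ∑ f_j / j!^s ζ^j`. -/
def borel (s : ℕ) : ℂ⟦X⟧ →ₗ[ℂ] ℂ⟦X⟧ where
  toFun f := PowerSeries.mk fun j => PowerSeries.coeff j f / (j ! : ℂ) ^ s
  map_add' f g := by ext j; simp [add_div]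
  map_smul' c f := by ext j; simp [mul_div_assoc]

theorem coeff_borel (s j : ℕ) (f : ℂ⟦X⟧) :
    PowerSeries.coeff j (borel s f) = PowerSeries.coeff j f / (j ! : ℂ) ^ s := by
  simp [borel]

theorem factorial_pow_ne_zero (s j : ℕ) : (j ! : ℂ) ^ s ≠ 0 :=
  pow_ne_zero _ (Nat.cast_ne_zero.2 j.factorial_ne_zero)

theorem coeff_factorialTransform_iterate (s j : ℕ) (f : ℂ⟦X⟧) :
    PowerSeries.coeff j (factorialTransform^[s] f) = (j ! : ℂ) ^ s * PowerSeries.coeff j f := by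
  induction s with
  | zero => simp
  | succ s ih =>
    rw [Function.iterate_succ_apply', factorialTransform, PowerSeries.coeff_mk, ih]; ring

theorem factorialTransform_iterate_borel (s : ℕ) (f : ℂ⟦X⟧) :
    factorialTransform^[s] (borel s f) = f := by
  ext j
  rw [coeff_factorialTransform_iterate, coeff_borel, mul_div_cancel₀ _ (factorial_pow_ne_zero s j)]

theorem coeff_formalEuler_pow (s j : ℕ) (f : ℂ⟦X⟧) :
    PowerSeries.coeff j (((LinearMap.mulLeft ℂ (PowerSeries.X : ℂ⟦X⟧) *
      (PowerSeries.derivative ℂ : Derivation ℂ ℂ⟦X⟧ ℂ⟦X⟧).toLinearMap + 1) ^ s) f) =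
      (j + 1 : ℂ) ^ s * PowerSeries.coeff j f := by
  induction s with
  | zero => simp
  | succ s ih =>
    rw [pow_succ', Module.End.mul_apply, LinearMap.add_apply, Module.End.mul_apply,
      Module.End.one_apply, map_add, ih, LinearMap.mulLeft_apply]
    cases j with
    | zero => simp
    | succ j =>
      rw [PowerSeries.coeff_succ_X_mul]
      change PowerSeries.coeff j (PowerSeries.derivative ℂ _) + _ = _
      rw [PowerSeries.coeff_derivative, ih]
      push_cast; ring

/-- The factor `(j+1)^s` of the operator cancels against `(j+1)!^s = (j+1)^s j!^s`. -/
theorem borel_formalDiffOp (s : ℕ) (f : ℂ⟦X⟧) :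
    borel s (formalDiffOp s f) = PowerSeries.X * borel s f := by
  ext j
  rw [coeff_borel, formalDiffOp, Module.End.mul_apply, LinearMap.mulLeft_apply]
  cases j with
  | zero => simp
  | succ j =>
    rw [PowerSeries.coeff_succ_X_mul, PowerSeries.coeff_succ_X_mul, coeff_formalEuler_pow,
      coeff_borel, Nat.factorial_succ, Nat.cast_mul, mul_pow, Nat.cast_succ]
    have : ((j : ℂ) + 1) ^ s ≠ 0 := pow_ne_zero _ (Nat.cast_add_one_ne_zero j)
    rw [mul_div_mul_left _ _ this]

theorem borel_aeval (s : ℕ) (P : Polynomial ℂ) (f : ℂ⟦X⟧) :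
    borel s (Polynomial.aeval (formalDiffOp s) P f) = (P : ℂ⟦X⟧) * borel s f := by
  have hpow : ∀ n : ℕ, borel s ((formalDiffOp s ^ n) f) = PowerSeries.X ^ n * borel s f := by
    intro n
    induction n with
    | zero => simp
    | succ n ih => rw [pow_succ', Module.End.mul_apply, borel_formalDiffOp, ih]; ring
  induction P using Polynomial.induction_on' with
  | add p q hp hq => simp [hp, hq, add_mul]
  | monomial n c =>
    rw [Polynomial.aeval_monomial, Module.End.mul_apply, Module.algebraMap_end_apply, map_smul,
      hpow, ← Polynomial.C_mul_X_pow_eq_monomial, Polynomial.coe_mul, Polynomial.coe_C,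
      Polynomial.coe_pow, Polynomial.coe_X, PowerSeries.smul_eq_C_mul, mul_assoc]

/-! ### Convergent series -/

theorem isConvergent_iff (g : ℂ⟦X⟧) : IsConvergent g ↔
    ∃ C M : ℝ, 0 < C ∧ 0 < M ∧ ∀ j, ‖PowerSeries.coeff j g‖ ≤ C * M ^ j := by
  constructor
  · rintro ⟨R, hR, h⟩
    have hs := h ((R / 2 : ℝ) : ℂ) (by
      rw [Complex.norm_real, Real.norm_of_nonneg (by positivity)]; linarith)
    obtain ⟨C, hC⟩ := hs.tendsto_atTop_zero.norm.bddAbove_range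
    refine ⟨max C 1, 2 / R, by positivity, by positivity, fun j => ?_⟩
    have h1 := hC (Set.mem_range_self j)
    simp only [norm_mul, norm_pow, Complex.norm_real] at h1
    rw [Real.norm_of_nonneg (by positivity : 0 ≤ R / 2)] at h1
    have h2 : ‖PowerSeries.coeff j g‖ * (R / 2) ^ j * (2 / R) ^ j ≤ max C 1 * (2 / R) ^ j := by
      gcongr
      exact h1.trans (le_max_left _ _)
    rwa [mul_assoc, ← mul_pow, div_mul_div_comm, mul_comm R 2, div_self (by positivity), one_pow,
      mul_one] at h2
  · rintro ⟨C, M, hC, hM, h⟩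
    refine ⟨1 / M, by positivity, fun z hz => ?_⟩
    rw [lt_div_iff₀ hM] at hz
    refine Summable.of_norm_bounded (g := fun j => C * (‖z‖ * M) ^ j)
      ((summable_geometric_of_lt_one (by positivity) hz).mul_left C) fun j => ?_
    rw [norm_mul, norm_pow, mul_pow]
    calc _ ≤ C * M ^ j * ‖z‖ ^ j := by gcongr; exact h j
      _ = _ := by ring

/-! ### The recurrence -/

theorem coeff_coe_mul {P : Polynomial ℂ} {r j : ℕ} (hr : P.natDegree ≤ r) (hj : r ≤ j)
    (q : ℂ⟦X⟧) : PowerSeries.coeff j ((P : ℂ⟦X⟧) * q) = P.coeff 0 * PowerSeries.coeff j q +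
      ∑ i ∈ Finset.Ico (j - r) j, P.coeff (j - i) * PowerSeries.coeff i q := by
  rw [mul_comm, PowerSeries.coeff_mul, Finset.Nat.sum_antidiagonal_eq_sum_range_succ_mk,
    Finset.sum_range_succ, Finset.range_eq_Ico,
    ← Finset.sum_Ico_consecutive _ (Nat.zero_le (j - r)) (Nat.sub_le j r)]
  rw [Finset.sum_eq_zero (s := Finset.Ico 0 (j - r)), zero_add, add_comm]
  · simp only [Polynomial.coeff_coe, Nat.sub_self, mul_comm]
  · intro i hi
    rw [Finset.mem_Ico] at hi
    rw [Polynomial.coeff_coe, Polynomial.coeff_eq_zero_of_natDegree_lt (by omega), mul_zero]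

theorem coeff_recPoly (r : ℕ) (a : ℕ → ℂ) (i : ℕ) : (recPoly r a).coeff i =
    (if i = 0 then 1 else 0) - if i ∈ Finset.Icc 1 r then a i else 0 := by
  rw [recPoly, Polynomial.coeff_sub, Polynomial.coeff_one, Polynomial.finsetSum_coeff]
  congr 1
  simp [Polynomial.coeff_C_mul, Polynomial.coeff_X_pow]

theorem natDegree_recPoly_le (r : ℕ) (a : ℕ → ℂ) : (recPoly r a).natDegree ≤ r := by
  rw [Polynomial.natDegree_le_iff_coeff_eq_zero]
  intro N hN
  rw [coeff_recPoly, if_neg (by omega), if_neg (by simp; omega), sub_zero]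

theorem coeff_recPoly_mul {r j : ℕ} (hj : r ≤ j) (a : ℕ → ℂ) (q : ℂ⟦X⟧) :
    PowerSeries.coeff j ((recPoly r a : ℂ⟦X⟧) * q) = PowerSeries.coeff j q -
      ∑ i ∈ Finset.Ico (j - r) j, a (j - i) * PowerSeries.coeff i q := by
  rw [coeff_coe_mul (natDegree_recPoly_le r a) hj, coeff_recPoly,
    sub_eq_add_neg (PowerSeries.coeff j q), ← Finset.sum_neg_distrib]
  congr 1
  · simp
  · refine Finset.sum_congr rfl fun i hi => ?_
    rw [Finset.mem_Ico] at hi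
    rw [coeff_recPoly, if_neg (by omega), if_pos (by simp; omega)]; ring

/-- A polynomial which does not vanish at the origin is a multiple of some `1 - a₁ z - ⋯`. -/
theorem exists_eq_C_mul_recPoly (P : Polynomial ℂ) (hP : P.eval 0 ≠ 0) :
    ∃ (r : ℕ) (a : ℕ → ℂ), 1 ≤ r ∧ P = Polynomial.C (P.eval 0) * recPoly r a := by
  refine ⟨P.natDegree + 1, fun i => -P.coeff i / P.eval 0, by omega, ?_⟩
  ext i
  rw [Polynomial.coeff_C_mul, coeff_recPoly]
  rcases Nat.eq_zero_or_pos i with rfl | hi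
  · simp [Polynomial.coeff_zero_eq_eval_zero]
  · rw [if_neg hi.ne']
    split_ifs with h
    · field_simp; ring
    · rw [Polynomial.coeff_eq_zero_of_natDegree_lt (by simp at h; omega)]; ring

theorem norm_coeff_borel (s j : ℕ) (g : ℂ⟦X⟧) :
    ‖PowerSeries.coeff j (borel s g)‖ = ‖PowerSeries.coeff j g‖ / (j ! : ℝ) ^ s := by
  rw [coeff_borel, norm_div, norm_pow, Complex.norm_natCast]

theorem recurrenceEstimate_of_isFormalSolution {s : ℕ} {f : ℂ⟦X⟧} (h : IsFormalSolution s f) :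
    RecurrenceEstimate s f := by
  obtain ⟨P, g, hP, hg, hPf⟩ := h
  obtain ⟨C, M, hC, hM, hgb⟩ := (isConvergent_iff g).1 hg
  obtain ⟨r, a, hr, ha⟩ := exists_eq_C_mul_recPoly P hP
  refine ⟨r, a, C / ‖P.eval 0‖, M, hr, by positivity, hM, fun j hj => ?_⟩
  have h1 := borel_aeval s P f
  rw [hPf] at h1
  have h2 : borel s g = PowerSeries.C (P.eval 0) * ((recPoly r a : ℂ⟦X⟧) * borel s f) := by
    rw [h1, ← mul_assoc, ← Polynomial.coe_C, ← Polynomial.coe_mul, ← ha]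
  have h3 := congrArg (PowerSeries.coeff j) h2
  rw [PowerSeries.coeff_C_mul, coeff_recPoly_mul hj.le] at h3
  simp only [coeff_borel] at h3
  have h4 := congrArg norm h3
  rw [norm_mul, ← coeff_borel, norm_coeff_borel] at h4
  have hP' : 0 < ‖P.eval 0‖ := norm_pos_iff.2 hP
  rw [← mul_le_mul_iff_right₀ hP', ← h4]
  calc _ ≤ C * M ^ j / (j ! : ℝ) ^ s := by gcongr; exact hgb j
    _ = _ := by field_simp

theorem isFormalSolution_of_recurrenceEstimate {s : ℕ} {f : ℂ⟦X⟧} (h : RecurrenceEstimate s f) :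
    IsFormalSolution s f := by
  obtain ⟨r, a, C, M, hr, hC, hM, hb⟩ := h
  refine ⟨recPoly r a, Polynomial.aeval (formalDiffOp s) (recPoly r a) f, ?_, ?_, rfl⟩
  · rw [← Polynomial.coeff_zero_eq_eval_zero, coeff_recPoly]; simp
  set g := Polynomial.aeval (formalDiffOp s) (recPoly r a) f with hg
  have hbor := borel_aeval s (recPoly r a) f
  rw [isConvergent_iff]
  -- The estimate says nothing for `j ≤ r`; the added sum covers these finitely many coefficients.
  refine ⟨C + ∑ i ∈ Finset.range (r + 1), ‖PowerSeries.coeff i g‖ / M ^ i, M, by positivity, hM,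
    fun j => ?_⟩
  rcases lt_or_ge r j with hj | hj
  · have h1 := hb j hj
    have h2 := congrArg (PowerSeries.coeff j) hbor
    rw [coeff_recPoly_mul hj.le] at h2
    simp only [coeff_borel] at h2
    rw [← h2, ← coeff_borel, norm_coeff_borel, div_le_div_iff_of_pos_right (by positivity)] at h1
    refine h1.trans ?_
    gcongr
    exact le_add_of_nonneg_right (by positivity)
  · have h1 : ‖PowerSeries.coeff j g‖ / M ^ j ≤
        ∑ i ∈ Finset.range (r + 1), ‖PowerSeries.coeff i g‖ / M ^ i :=
      Finset.single_le_sum (f := fun i => ‖PowerSeries.coeff i g‖ / M ^ i)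
        (fun i _ => by positivity) (Finset.mem_range.2 (by omega))
    rw [← div_le_iff₀ (by positivity)]
    linarith

/-! ### Expansions of entire functions and of quotients by polynomials -/

/-- Because `p! N! ≤ (p+N)!`, the factor `1 / N!^s` splits off from the whole tail. -/
theorem norm_term_le {γ : ℂ⟦X⟧} {s : ℕ} {C M : ℝ}
    (h : ∀ j, ‖PowerSeries.coeff j γ‖ ≤ C * M ^ j / (j ! : ℝ) ^ s) (hC : 0 < C) (hM : 0 < M)
    (N p : ℕ) (w : ℂ) : ‖PowerSeries.coeff (p + N) γ * cexp w ^ (p + N)‖ ≤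
      C * M ^ N * (1 / (N ! : ℝ) ^ s) * Real.exp (N * w.re) *
        ((M * Real.exp w.re) ^ p / (p ! : ℝ) ^ s) := by
  rw [norm_mul, norm_pow, Complex.norm_exp]
  have hf : ((p ! : ℝ) * N !) ^ s ≤ ((p + N) ! : ℝ) ^ s := by
    gcongr
    exact_mod_cast Nat.le_of_dvd (Nat.factorial_pos _) (Nat.factorial_mul_factorial_dvd_factorial_add p N)
  calc _ ≤ C * M ^ (p + N) / ((p + N) ! : ℝ) ^ s * Real.exp w.re ^ (p + N) := by
        gcongr; exact h _
    _ ≤ C * M ^ (p + N) / ((p ! : ℝ) * N !) ^ s * Real.exp w.re ^ (p + N) := by gcongr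
    _ = _ := by
        rw [Real.exp_nat_mul, mul_pow, mul_pow, pow_add, pow_add]
        field_simp

/-- Writing `x = Y^s`, the term is `(Y^p / p!)^s`; all but one factor are bounded by `e^Y`, leaving
a summable exponential series. -/
theorem pow_div_factorial_pow_le {x : ℝ} (hx : 0 < x) {s : ℕ} (hs : 1 ≤ s) (p : ℕ) :
    x ^ p / (p ! : ℝ) ^ s ≤ Real.exp (Real.exp (Real.log x / s)) ^ (s - 1) *
      (Real.exp (Real.log x / s) ^ p / p !) := by
  have hs0 : (s : ℝ) ≠ 0 := by positivity
  set Y := Real.exp (Real.log x / s) with hY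
  have hxY : x = Y ^ s := by
    rw [hY, ← Real.exp_nat_mul, mul_div_cancel₀ _ hs0, Real.exp_log hx]
  have hYp : 0 < Y := Real.exp_pos _
  obtain ⟨n, rfl⟩ : ∃ n, s = n + 1 := ⟨s - 1, by omega⟩
  rw [hxY, ← pow_mul, mul_comm (n + 1) p, pow_mul, ← div_pow, pow_succ, Nat.add_sub_cancel]
  gcongr
  exact Real.pow_div_factorial_le_exp Y hYp.le p

theorem summable_pow_div_factorial_pow {x : ℝ} (hx : 0 < x) {s : ℕ} (hs : 1 ≤ s) :
    Summable fun p : ℕ => x ^ p / (p ! : ℝ) ^ s :=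
  Summable.of_nonneg_of_le (fun p => by positivity) (pow_div_factorial_pow_le hx hs)
    ((Real.summable_pow_div_factorial _).mul_left _)

theorem tsum_pow_div_factorial_pow_le {x : ℝ} (hx : 0 < x) {s : ℕ} (hs : 1 ≤ s) :
    ∑' p : ℕ, x ^ p / (p ! : ℝ) ^ s ≤ Real.exp (s * Real.exp (Real.log x / s)) := by
  refine ((summable_pow_div_factorial_pow hx hs).tsum_le_tsum (pow_div_factorial_pow_le hx hs)
    ((Real.summable_pow_div_factorial _).mul_left _)).trans_eq ?_
  have e := congrFun (NormedSpace.exp_eq_tsum_div (𝔸 := ℝ)) (Real.exp (Real.log x / s))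
  rw [← Real.exp_eq_exp_ℝ] at e
  rw [tsum_mul_left, ← e, ← pow_succ, Nat.sub_add_cancel hs,
    ← Real.exp_nat_mul]

/-- A series with coefficients `O(M^j / j!^s)` defines an entire function of exponential growth
of order `1 / s`, with expansion in the strong sense. -/
theorem hasExpansion_tsum {γ : ℂ⟦X⟧} {s : ℕ} (hs : 1 ≤ s) {C M : ℝ} (hC : 0 < C) (hM : 0 < M)
    (h : ∀ j, ‖PowerSeries.coeff j γ‖ ≤ C * M ^ j / (j ! : ℝ) ^ s) (d a : ℝ) :
    HasExpansion (fun N => 1 / (N ! : ℝ) ^ s) s d a γ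
      fun w => ∑' j : ℕ, PowerSeries.coeff j γ * cexp w ^ j := by
  have hx : ∀ w : ℂ, 0 < M * Real.exp w.re := fun w => by positivity
  have hsum := fun w : ℂ => summable_pow_div_factorial_pow (hx w) hs
  have hterm : ∀ (w : ℂ) (p : ℕ), ‖PowerSeries.coeff p γ * cexp w ^ p‖ ≤
      C * ((M * Real.exp w.re) ^ p / (p ! : ℝ) ^ s) := fun w p => by
    simpa using norm_term_le h hC hM 0 p w
  refine ⟨fun w₀ _ => ?_, fun b _ => ⟨s * Real.exp (Real.log M / s), C, M, by positivity, hC, hM,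
    fun N w _ => ?_⟩⟩
  · have ho : IsOpen {w : ℂ | w.re < w₀.re + 1} := isOpen_lt continuous_re continuous_const
    have := differentiableOn_tsum_of_summable_norm (hsum (w₀ + 1) |>.mul_left C)
      (F := fun p w => PowerSeries.coeff p γ * cexp w ^ p)
      (fun p => Differentiable.differentiableOn (by fun_prop)) ho fun p w hw => by
        refine (hterm w p).trans ?_
        have : w.re ≤ (w₀ + 1).re := by simpa using (le_of_lt hw)
        gcongr
    exact (this.differentiableAt (ho.mem_nhds (by simp))).differentiableWithinAt
  · have hS : Summable fun p : ℕ => PowerSeries.coeff p γ * cexp w ^ p :=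
      Summable.of_norm_bounded ((hsum w).mul_left C) (hterm w)
    beta_reduce
    rw [← hS.sum_add_tsum_nat_add N, add_sub_cancel_left]
    refine (tsum_of_norm_bounded ((hsum w).mul_left _).hasSum (norm_term_le h hC hM N · w)).trans ?_
    rw [tsum_mul_left]
    have hle := tsum_pow_div_factorial_pow_le (hx w) hs
    rw [Real.log_mul hM.ne' (Real.exp_ne_zero _), Real.log_exp, add_div, Real.exp_add,
      ← mul_assoc] at hle
    gcongr

/-! ### Division of expansions by a polynomial -/

section Division

variable {m : ℕ} {d a : ℝ} {G : ℂ → ℂ}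

theorem HasExpansion.mono {B B' : ℕ → ℝ} {f : ℂ⟦X⟧} (h : HasExpansion B m d a f G)
    (hB : ∀ N, B N ≤ B' N) : HasExpansion B' m d a f G := by
  refine ⟨h.1, fun b hb => ?_⟩
  obtain ⟨c, K, A, hc, hK, hA, h⟩ := h.2 b hb
  refine ⟨c, K, A, hc, hK, hA, fun N w hw => (h N w hw).trans ?_⟩
  have := hB N
  gcongr

theorem HasExpansion.norm_coeff_le {f : ℂ⟦X⟧} (ha : 0 < a)
    (h : HasExpansion (fun _ => 1) m d a f G) :
    ∃ K A : ℝ, 0 < K ∧ 0 < A ∧ ∀ N, ‖PowerSeries.coeff N f‖ ≤ K * A ^ N := by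
  obtain ⟨c, K, A, hc, hK, hA, h⟩ := h.2 0 ha
  refine ⟨K * (1 + A) * Real.exp (c * Real.exp (0 / m)), A, by positivity, hA, fun N => ?_⟩
  -- Two consecutive remainders at a point with `|z| = 1` differ by the `N`-th coefficient times a
  -- unimodular number.
  have h1 := h N (d * I) (by simp)
  have h2 := h (N + 1) (d * I) (by simp)
  rw [Finset.sum_range_succ] at h2
  have e : PowerSeries.coeff N f * cexp (d * I) ^ N =
      (G (d * I) - ∑ p ∈ Finset.range N, PowerSeries.coeff p f * cexp (d * I) ^ p) -
      (G (d * I) - (∑ p ∈ Finset.range N, PowerSeries.coeff p f * cexp (d * I) ^ p +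
        PowerSeries.coeff N f * cexp (d * I) ^ N)) := by ring
  have h3 := congrArg norm e
  rw [norm_mul, norm_pow, Complex.norm_exp_ofReal_mul_I, one_pow, mul_one] at h3
  rw [h3]
  refine (norm_sub_le _ _).trans ((add_le_add h1 h2).trans_eq ?_)
  simp; ring

/-- Induction on `ψ_{N+1} = χ_{N+1} + b ψ_N`, where `χ` is the product. The ratio is at least `A`
and at least `2‖b‖`, so each summand takes at most half of the bound. -/
theorem norm_coeff_le_of_mul {b : ℂ} {ψ : ℂ⟦X⟧} {K A : ℝ} (hK : 0 < K) (hA : 0 < A)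
    (h : ∀ N, ‖PowerSeries.coeff N ((1 - PowerSeries.C b * PowerSeries.X) * ψ)‖ ≤ K * A ^ N)
    (N : ℕ) : ‖PowerSeries.coeff N ψ‖ ≤ 2 * K * (A + 2 * ‖b‖ + 1) ^ N := by
  have hA' : 0 < A + 2 * ‖b‖ + 1 := by positivity
  induction N with
  | zero =>
    have := h 0
    simp [sub_mul, mul_assoc] at this ⊢
    linarith
  | succ N ih =>
    have h1 := h (N + 1)
    rw [sub_mul, one_mul, mul_assoc, map_sub, PowerSeries.coeff_C_mul,
      PowerSeries.coeff_succ_X_mul] at h1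
    have h2 : ‖PowerSeries.coeff (N + 1) ψ‖ ≤ K * A ^ (N + 1) + ‖b‖ * ‖PowerSeries.coeff N ψ‖ := by
      have := norm_add_le (PowerSeries.coeff (N + 1) ψ - b * PowerSeries.coeff N ψ)
        (b * PowerSeries.coeff N ψ)
      rw [sub_add_cancel, norm_mul] at this
      linarith
    have h3 : K * A ^ (N + 1) ≤ K * (A + 2 * ‖b‖ + 1) ^ (N + 1) := by
      gcongr
      linarith [norm_nonneg b]
    have h4 : ‖b‖ * ‖PowerSeries.coeff N ψ‖ ≤ ‖b‖ * (2 * K * (A + 2 * ‖b‖ + 1) ^ N) := by gcongr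
    have h5 : ‖b‖ * (2 * K * (A + 2 * ‖b‖ + 1) ^ N) ≤ K * (A + 2 * ‖b‖ + 1) ^ (N + 1) := by
      rw [pow_succ]
      have : 0 ≤ K * (A + 2 * ‖b‖ + 1) ^ N := by positivity
      nlinarith
    linarith

/-- Truncation and multiplication by `1 - b z` commute up to one boundary term. Its coefficient
`ψ_{N-1}` is written through `X ψ` so that `N = 0` is included. -/
theorem one_sub_mul_sum (b z : ℂ) (ψ : ℂ⟦X⟧) (N : ℕ) :
    (1 - b * z) * ∑ p ∈ Finset.range N, PowerSeries.coeff p ψ * z ^ p =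
      ∑ p ∈ Finset.range N,
        PowerSeries.coeff p ((1 - PowerSeries.C b * PowerSeries.X) * ψ) * z ^ p -
      b * PowerSeries.coeff N (PowerSeries.X * ψ) * z ^ N := by
  induction N with
  | zero => simp
  | succ N ih =>
    rw [Finset.sum_range_succ, Finset.sum_range_succ, mul_add, ih, PowerSeries.coeff_succ_X_mul,
      sub_mul, one_mul, mul_assoc, map_sub, PowerSeries.coeff_C_mul]
    ring

theorem HasExpansion.div_one_sub {b : ℂ} {ψ : ℂ⟦X⟧} {κ : ℝ} (ha : 0 < a) (hκ : 0 < κ)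
    (hb : ∀ w ∈ strip d a, κ ≤ ‖1 - b * cexp w‖)
    (h : HasExpansion (fun _ => 1) m d a ((1 - PowerSeries.C b * PowerSeries.X) * ψ) G) :
    HasExpansion (fun _ => 1) m d a ψ fun w => G w / (1 - b * cexp w) := by
  have hne : ∀ w ∈ strip d a, 1 - b * cexp w ≠ 0 := fun w hw => norm_pos_iff.1 (hκ.trans_le (hb w hw))
  refine ⟨h.1.div (Differentiable.differentiableOn (by fun_prop)) hne, fun b₀ hb₀ => ?_⟩
  obtain ⟨K', A', hK', hA', hco⟩ := h.norm_coeff_le ha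
  have hψ := norm_coeff_le_of_mul hK' hA' hco
  obtain ⟨c, K, A, hc, hK, hA, h⟩ := h.2 b₀ hb₀
  set A₁ := A' + 2 * ‖b‖ + 1 with hA₁
  have hA₁1 : 1 ≤ A₁ := by have := norm_nonneg b; linarith
  refine ⟨c, (K + ‖b‖ * (2 * K')) / κ, A + A₁, hc, by positivity, by positivity, fun N w hw => ?_⟩
  have hws : w ∈ strip d a := hw.trans_lt hb₀
  have e : G w / (1 - b * cexp w) - ∑ p ∈ Finset.range N, PowerSeries.coeff p ψ * cexp w ^ p =
      ((G w - ∑ p ∈ Finset.range N, PowerSeries.coeff p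
        ((1 - PowerSeries.C b * PowerSeries.X) * ψ) * cexp w ^ p) +
        b * PowerSeries.coeff N (PowerSeries.X * ψ) * cexp w ^ N) / (1 - b * cexp w) := by
    have := one_sub_mul_sum b (cexp w) ψ N
    rw [eq_div_iff (hne w hws), sub_mul, div_mul_cancel₀ _ (hne w hws), mul_comm (Finset.sum _ _),
      this]
    ring
  have hX : ‖PowerSeries.coeff N (PowerSeries.X * ψ)‖ ≤ 2 * K' * A₁ ^ N := by
    cases N with
    | zero => simpa using hK'.le
    | succ N =>
      rw [PowerSeries.coeff_succ_X_mul]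
      refine (hψ N).trans ?_
      gcongr
      omega
  have hW : 1 ≤ Real.exp (c * Real.exp (w.re / m)) := Real.one_le_exp (by positivity)
  have h1 : ‖b * PowerSeries.coeff N (PowerSeries.X * ψ) * cexp w ^ N‖ ≤
      ‖b‖ * (2 * K') * (A + A₁) ^ N * Real.exp (N * w.re) * Real.exp (c * Real.exp (w.re / m)) := by
    rw [norm_mul, norm_mul, norm_pow, Complex.norm_exp, ← Real.exp_nat_mul]
    refine le_trans ?_ (le_mul_of_one_le_right (by positivity) hW)
    rw [mul_assoc ‖b‖ (2 * K')]
    gcongr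
    refine hX.trans ?_
    gcongr
    linarith
  have h2 : ‖G w - ∑ p ∈ Finset.range N, PowerSeries.coeff p
      ((1 - PowerSeries.C b * PowerSeries.X) * ψ) * cexp w ^ p‖ ≤
      K * (A + A₁) ^ N * Real.exp (N * w.re) * Real.exp (c * Real.exp (w.re / m)) := by
    refine (h N w hw).trans ?_
    rw [mul_one]
    gcongr
    linarith
  rw [e, norm_div]
  calc _ ≤ (K * (A + A₁) ^ N * Real.exp (N * w.re) * Real.exp (c * Real.exp (w.re / m)) +
        ‖b‖ * (2 * K') * (A + A₁) ^ N * Real.exp (N * w.re) *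
          Real.exp (c * Real.exp (w.re / m))) / κ := by
        gcongr
        · exact (norm_add_le _ _).trans (add_le_add h2 h1)
        · exact hb w hws
    _ = _ := by ring

theorem HasExpansion.const_mul {f : ℂ⟦X⟧} {B : ℕ → ℝ} (h : HasExpansion B m d a f G)
    (hB : ∀ N, 0 ≤ B N) (c₀ : ℂ) :
    HasExpansion B m d a (PowerSeries.C c₀ * f) fun w => c₀ * G w := by
  refine ⟨h.1.const_mul c₀, fun b hb => ?_⟩
  obtain ⟨c, K, A, hc, hK, hA, h⟩ := h.2 b hb
  refine ⟨c, (‖c₀‖ + 1) * K, A, hc, by positivity, hA, fun N w hw => ?_⟩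
  have e : c₀ * G w - ∑ p ∈ Finset.range N, PowerSeries.coeff p (PowerSeries.C c₀ * f) * cexp w ^ p =
      c₀ * (G w - ∑ p ∈ Finset.range N, PowerSeries.coeff p f * cexp w ^ p) := by
    rw [mul_sub, Finset.mul_sum]
    congr 1
    exact Finset.sum_congr rfl fun p _ => by rw [PowerSeries.coeff_C_mul]; ring
  have hBN := hB N
  rw [e, norm_mul]
  calc _ ≤ (‖c₀‖ + 1) * (K * A ^ N * B N * Real.exp (N * w.re) *
        Real.exp (c * Real.exp (w.re / m))) := by
        gcongr
        · linarith
        · exact h N w hw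
    _ = _ := by ring

/-- Division of an expansion by a polynomial bounded away from zero on the strip. -/
theorem HasExpansion.div_poly (ha : 0 < a) (P : Polynomial ℂ) (hP : P.eval 0 ≠ 0)
    (hroot : ∀ z : ℂ, P.IsRoot z → ∃ κ > 0, ∀ w ∈ strip d a, κ ≤ ‖1 - z⁻¹ * cexp w‖)
    (ψ : ℂ⟦X⟧) (h : HasExpansion (fun _ => 1) m d a ((P : ℂ⟦X⟧) * ψ) G) :
    HasExpansion (fun _ => 1) m d a ψ fun w => G w / P.eval (cexp w) := by
  induction hn : P.natDegree generalizing P G with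
  | zero =>
    rw [Polynomial.eq_C_of_natDegree_eq_zero hn] at h hP ⊢
    set c := P.coeff 0
    rw [Polynomial.eval_C] at hP
    have := h.const_mul (fun _ => zero_le_one) c⁻¹
    rw [Polynomial.coe_C, ← mul_assoc, ← map_mul, inv_mul_cancel₀ hP, map_one, one_mul] at this
    simpa [div_eq_inv_mul] using this
  | succ n ih =>
    obtain ⟨z, hz⟩ := Complex.exists_root (f := P) (Polynomial.natDegree_pos_iff_degree_pos.1
      (by omega))
    have hz0 : z ≠ 0 := by rintro rfl; exact hP hz
    obtain ⟨Q, hQ⟩ := Polynomial.dvd_iff_isRoot.2 hz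
    -- The factor `X - z` is rescaled to constant term one, the form handled by
    -- `HasExpansion.div_one_sub`.
    have hPQ : P = (1 - Polynomial.C z⁻¹ * Polynomial.X) * (Polynomial.C (-z) * Q) := by
      rw [hQ, ← mul_assoc]
      congr 1
      have : Polynomial.C z⁻¹ * Polynomial.C z = 1 := by
        rw [← Polynomial.C_mul, inv_mul_cancel₀ hz0, Polynomial.C_1]
      rw [Polynomial.C_neg]
      linear_combination -Polynomial.X * this
    set Q' := Polynomial.C (-z) * Q with hQ'
    have hP0 : P ≠ 0 := by rintro rfl; simp at hP
    have hQ0 : Q ≠ 0 := by rintro rfl; simp [hQ] at hP0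
    have hdeg : Q'.natDegree = n := by
      rw [hQ', Polynomial.natDegree_C_mul (neg_ne_zero.2 hz0)]
      have := Polynomial.natDegree_mul (Polynomial.X_sub_C_ne_zero z) hQ0
      rw [← hQ, hn, Polynomial.natDegree_X_sub_C] at this
      omega
    obtain ⟨κ, hκ, hκb⟩ := hroot z hz
    have hroot' : ∀ u : ℂ, Q'.IsRoot u → P.IsRoot u := fun u hu => by
      rw [Polynomial.IsRoot, hPQ, Polynomial.eval_mul, hu.eq_zero, mul_zero]
    have h1 : HasExpansion (fun _ => 1) m d a ((Q' : ℂ⟦X⟧) * ψ) fun w => G w / (1 - z⁻¹ * cexp w) := by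
      refine HasExpansion.div_one_sub ha hκ hκb ?_
      have e : (P : ℂ⟦X⟧) * ψ =
          (1 - PowerSeries.C z⁻¹ * PowerSeries.X) * ((Q' : ℂ⟦X⟧) * ψ) := by
        conv_lhs => rw [hPQ]
        simp [mul_assoc]
      rwa [e] at h
    have h2 := ih Q' (fun h0 => hP (hroot' 0 h0)) (fun u hu => hroot u (hroot' u hu)) h1 hdeg
    convert h2 using 2 with w
    rw [hPQ, Polynomial.eval_mul, div_div]
    simp

end Division

/-! ### Nonsingular directions -/

/-- A lower bound depending on the argument only, hence uniform along unbounded sectors. With `r =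
|e^u|` and `c = cos (Im u)` the right side is `(r - c)^2 + (1 - c)(1 + c)`, which suffices for `c ≥
0`; for `c ≤ 0` it is at least one. -/
theorem one_sub_cos_div_two_le (u : ℂ) : (1 - Real.cos u.im) / 2 ≤ ‖1 - cexp u‖ ^ 2 := by
  have h1 : ‖1 - cexp u‖ ^ 2 = (1 - Real.exp u.re * Real.cos u.im) ^ 2 +
      (Real.exp u.re * Real.sin u.im) ^ 2 := by
    rw [Complex.sq_norm, Complex.normSq_apply, sub_re, sub_im, exp_re, exp_im]
    simp; ring
  have h2 := Real.sin_sq_add_cos_sq u.im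
  have h3 := Real.cos_le_one u.im
  have h4 := Real.neg_one_le_cos u.im
  have hr := Real.exp_pos u.re
  rw [h1]
  generalize Real.exp u.re = r at *
  generalize Real.cos u.im = c at *
  have e : (1 - r * c) ^ 2 + (r * Real.sin u.im) ^ 2 = 1 - 2 * (r * c) + r ^ 2 := by
    linear_combination r ^ 2 * h2
  rw [e]
  rcases le_total c 0 with hc | hc
  · nlinarith
  · nlinarith [sq_nonneg (r - c), mul_nonneg (sub_nonneg.2 h3) (by linarith : (0:ℝ) ≤ 1 + 2 * c)]

theorem exists_strip_of_root {z : ℂ} (hz : z ≠ 0) {d : ℝ}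
    (hd : (Complex.arg z : Real.Angle) ≠ (d : Real.Angle)) :
    ∃ a > 0, ∃ κ > 0, ∀ w ∈ strip d a, κ ≤ ‖1 - z⁻¹ * cexp w‖ := by
  have hcos : Real.cos (d - z.arg) < 1 := by
    refine lt_of_le_of_ne (Real.cos_le_one _) fun h => hd ?_
    obtain ⟨n, hn⟩ := (Real.cos_eq_one_iff _).1 h
    rw [eq_comm, Real.Angle.angle_eq_iff_two_pi_dvd_sub]
    exact ⟨n, by linarith⟩
  obtain ⟨q, hq1, hq2⟩ := exists_between hcos
  have hcont : Continuous fun y : ℝ => Real.cos (y - z.arg) := by fun_prop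
  obtain ⟨a, ha, hball⟩ := Metric.isOpen_iff.1 (isOpen_lt hcont continuous_const) d hq1
  refine ⟨a, ha, Real.sqrt ((1 - q) / 2), Real.sqrt_pos.2 (by linarith), fun w hw => ?_⟩
  have h1 : Real.cos (w.im - z.arg) < q := hball (by
    rw [Metric.mem_ball, Real.dist_eq]; exact hw)
  have h2 := one_sub_cos_div_two_le (w - Complex.log z)
  rw [Complex.exp_sub, Complex.exp_log hz, sub_im, Complex.log_im, div_eq_inv_mul (cexp w)] at h2
  exact Real.sqrt_le_iff.2 ⟨norm_nonneg _, by linarith⟩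

theorem strip_subset (d : ℝ) {a b : ℝ} (h : a ≤ b) : strip d a ⊆ strip d b :=
  fun _ hw => LT.lt.trans_le (b := a) hw h

theorem exists_strip_of_nonsingular {P : Polynomial ℂ} (hP : P.eval 0 ≠ 0) {d : ℝ}
    (hd : IsNonsingularDirection P d) : ∃ a > 0, ∀ z : ℂ, P.IsRoot z →
      ∃ κ > 0, ∀ w ∈ strip d a, κ ≤ ‖1 - z⁻¹ * cexp w‖ := by
  have hP0 : P ≠ 0 := by rintro rfl; simp at hP
  have key : ∀ S : Finset ℂ, (∀ z ∈ S, P.IsRoot z) → ∃ a > 0, ∀ z ∈ S,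
      ∃ κ > 0, ∀ w ∈ strip d a, κ ≤ ‖1 - z⁻¹ * cexp w‖ := by
    intro S
    induction S using Finset.induction_on with
    | empty => exact fun _ => ⟨1, one_pos, by simp⟩
    | insert z S _ ih =>
      intro hS
      obtain ⟨a, ha, h⟩ := ih fun u hu => hS u (Finset.mem_insert_of_mem hu)
      have hz := hS z (Finset.mem_insert_self z S)
      obtain ⟨a', ha', κ, hκ, h'⟩ := exists_strip_of_root (z := z)
        (by rintro rfl; exact hP hz) (hd z hz)
      refine ⟨min a a', lt_min ha ha', fun u hu => ?_⟩
      rcases Finset.mem_insert.1 hu with rfl | hu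
      · exact ⟨κ, hκ, fun w hw => h' w (strip_subset d (min_le_right _ _) hw)⟩
      · obtain ⟨κ', hκ', h''⟩ := h u hu
        exact ⟨κ', hκ', fun w hw => h'' w (strip_subset d (min_le_left _ _) hw)⟩
  classical
  obtain ⟨a, ha, h⟩ := key P.roots.toFinset fun z hz => by
    rw [Multiset.mem_toFinset, Polynomial.mem_roots hP0] at hz; exact hz
  exact ⟨a, ha, fun z hz => h z (by rwa [Multiset.mem_toFinset, Polynomial.mem_roots hP0])⟩

/-! ### Summability of formal solutions -/

theorem laplaceIter_congr {d a : ℝ} (ha : 0 < a) {G H : ℂ → ℂ} (h : Set.EqOn G H (strip d a))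
    (n : ℕ) : Set.EqOn (laplaceIter d a n G) (laplaceIter d a n H)
      (strip d (a + n * (Real.pi / 2))) := by
  induction n with
  | zero => simpa [laplaceIter] using h
  | succ n ih =>
    intro w hw
    rw [add_succ_mul_pi] at hw
    exact laplace_congr (by positivity) ih hw

theorem HasExpansion.exists_laplaceIter_bound {d a : ℝ} (ha : 0 < a) {B : ℕ → ℝ}
    (hB : ∀ N, 0 < B N) {f : ℂ⟦X⟧} {G : ℂ → ℂ} {s : ℕ} (hs : 1 ≤ s)
    (hG : HasExpansion B s d a f G) {b : ℝ} (hb : 0 < b) (hba : b < a + s * (Real.pi / 2)) :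
    ∃ R₀ K A : ℝ, 0 < K ∧ 0 < A ∧ ∀ (N : ℕ), ∀ w ∈ logSector d b R₀,
      ‖GevreySum.laplaceIter d a s G w - ∑ p ∈ Finset.range N,
        PowerSeries.coeff p (factorialTransform^[s] f) * cexp w ^ p‖ ≤
        K * A ^ N * (B N * (N ! : ℝ) ^ s) * Real.exp (N * w.re) := by
  obtain ⟨n, rfl⟩ : ∃ n, s = n + 1 := ⟨s - 1, by omega⟩
  rw [add_succ_mul_pi] at hba
  obtain ⟨R₀, K, A, hK, hA, h⟩ := (hG.laplaceIter ha hB n one_ne_zero).exists_laplace_bound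
    (by positivity) (fun N => mul_pos (hB N) (by positivity)) hb hba
  refine ⟨R₀, K, A, hK, hA, fun N w hw => ?_⟩
  have := h N w hw
  rw [mul_assoc (B N), ← pow_succ, ← Function.iterate_succ_apply' factorialTransform] at this
  exact this

theorem exists_differentiableOn_laplaceIter {d a : ℝ} (ha : 0 < a) {G : ℂ → ℂ} {s : ℕ}
    (hs : 1 ≤ s) (hG : ExpGrowth s d a G) {b : ℝ} (hb : 0 < b)
    (hba : b < a + s * (Real.pi / 2)) :
    ∃ R₀ : ℝ, DifferentiableOn ℂ (laplaceIter d a s G) (logSector d b R₀) := by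
  obtain ⟨n, rfl⟩ : ∃ n, s = n + 1 := ⟨s - 1, by omega⟩
  rw [add_succ_mul_pi] at hba
  obtain ⟨R₀, h⟩ := (hG.laplaceIter ha n one_ne_zero).exists_laplaceBound (by positivity) hb hba
  exact ⟨R₀, (h R₀ le_rfl).differentiableOn_laplace (by positivity) hb hba⟩

theorem logSector_subset (d b : ℝ) {R R' : ℝ} (h : R ≤ R') : logSector d b R ⊆ logSector d b R' :=
  fun _ hw => ⟨hw.1, hw.2.trans_le h⟩

theorem sector_eq_logSector (d b R : ℝ) :
    sector d (2 * b / Real.pi) (Real.exp R) = logSector d b R := by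
  have : Real.pi * (2 * b / Real.pi) / 2 = b := by field_simp
  ext w
  simp only [sector, logSector, LogSurface.arg, LogSurface.abs, Set.mem_ofPred_eq, this,
    Real.exp_lt_exp]

theorem summableToSolution_of_isFormalSolution {s : ℕ} {k : ℝ} (hs : 1 ≤ s)
    (hk : (s : ℝ) = 1 / k) {f : ℂ⟦X⟧} (h : IsFormalSolution s f) : SummableToSolution k s f := by
  obtain ⟨P, g, hP, hg₀, hPf⟩ := h
  have hg := hg₀
  obtain ⟨C, M, hC, hM, hgb⟩ := (isConvergent_iff g).1 hg
  obtain ⟨Rg, hRg, hsum⟩ := hg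
  obtain ⟨r, c, hr, hc⟩ := exists_eq_C_mul_recPoly P hP
  refine ⟨r, c, P, g, hr, hP, hg₀, fun d hd => ?_⟩
  have hd' : IsNonsingularDirection P d := fun z hz => hd z (by
    rw [Polynomial.IsRoot, hc, Polynomial.eval_mul, Polynomial.eval_C] at hz
    exact (mul_eq_zero.1 hz).resolve_left hP)
  obtain ⟨a, ha, hroot⟩ := exists_strip_of_nonsingular hP hd'
  have hbor := borel_aeval s P f
  rw [hPf] at hbor
  have hΓ := hasExpansion_tsum (γ := borel s g) hs hC hM (fun j => by
    rw [norm_coeff_borel]; gcongr; exact hgb j) d a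
  set Γ : ℂ → ℂ := fun w => ∑' j : ℕ, PowerSeries.coeff j (borel s g) * cexp w ^ j
  have hφ : HasExpansion (fun _ => 1) s d a (borel s f) fun w => Γ w / P.eval (cexp w) := by
    refine HasExpansion.div_poly ha P hP hroot _ (HasExpansion.mono (hbor ▸ hΓ) fun N => ?_)
    rw [div_le_one (by positivity)]
    exact one_le_pow₀ (by exact_mod_cast N.factorial_pos)
  set Φ : ℂ → ℂ := fun w => Γ w / P.eval (cexp w)
  have hPΦ : Set.EqOn (fun v => P.eval (cexp v) * Φ v) Γ (strip d a) := by
    intro v hv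
    refine mul_div_cancel₀ _ fun h0 => ?_
    obtain ⟨κ, hκ, hb⟩ := hroot _ h0
    have := hb v hv
    rw [inv_mul_cancel₀ (Complex.exp_ne_zero v), sub_self, norm_zero] at this
    linarith
  have hpi := Real.pi_pos
  -- The half-opening `b` exceeds `s π/2` as `k`-summability requires; the room for it comes from
  -- the width `a` of the root-free strip.
  obtain ⟨b, hb1, hb2⟩ := exists_between (show (s : ℝ) * (Real.pi / 2) < a + s * (Real.pi / 2) by
    linarith)
  have hb : 0 < b := lt_of_le_of_lt (by positivity) hb1
  have hΦg := hφ.expGrowth one_pos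
  obtain ⟨R₁, K, A, hK, hA, h₁⟩ := hφ.exists_laplaceIter_bound ha (fun _ => one_pos) hs hb hb2
  obtain ⟨R₂, h₂⟩ := exists_polyDiffOp_laplaceIter ha hs hΦg P hb hb2
  obtain ⟨R₃, K', A', hK', hA', h₃⟩ :=
    hΓ.exists_laplaceIter_bound ha (fun N => by positivity) hs hb hb2
  obtain ⟨R₄, h₄⟩ := exists_differentiableOn_laplaceIter ha hs hΦg hb hb2
  -- The last two conditions force `|z| < Rg`, so that `g` converges, and `A' |z| < 1`, so that the
  -- remainders of the transform of `Γ` tend to zero.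
  obtain ⟨R, hR₁, hR₂, hR₃, hR₄, hR₅, hR₆⟩ : ∃ R : ℝ, R ≤ R₁ ∧ R ≤ R₂ ∧ R ≤ R₃ ∧ R ≤ R₄ ∧
      R ≤ Real.log Rg ∧ R ≤ -Real.log A' :=
    ⟨min R₁ (min R₂ (min R₃ (min R₄ (min (Real.log Rg) (-Real.log A'))))), by simp⟩
  rw [factorialTransform_iterate_borel] at h₁ h₃
  refine ⟨2 * b / Real.pi, Real.exp R, laplaceIter d a s Φ, ⟨?_, Real.exp_pos R, ?_, ?_⟩, ?_⟩
  · rw [← hk, lt_div_iff₀ hpi]; linarith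
  · rw [sector_eq_logSector]
    exact h₄.mono (logSector_subset d b hR₄)
  · intro d' θ' ρ' _ _ hsub
    rw [sector_eq_logSector] at hsub
    refine ⟨K, A, hK, hA, fun N w hw => ?_⟩
    have := h₁ N w (logSector_subset d b hR₁ (hsub (subset_closure hw)))
    rw [← hk, Real.rpow_natCast, LogSurface.abs, ← Real.exp_nat_mul]
    rwa [one_mul] at this
  · intro w hw
    rw [sector_eq_logSector] at hw
    have e : polyDiffOp s P (laplaceIter d a s Φ) w = laplaceIter d a s Γ w :=
      (h₂ (logSector_subset d b hR₂ hw)).trans (laplaceIter_congr ha hPΦ s (hw.1.trans hb2))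
    rw [e]
    have hS : Summable fun n : ℕ => PowerSeries.coeff n g * w.proj ^ n := by
      refine hsum _ ?_
      rw [LogSurface.proj, Complex.norm_exp, ← Real.lt_log_iff_exp_lt hRg]
      exact hw.2.trans_le hR₅
    rw [hS.hasSum_iff_tendsto_nat]
    have hlt : A' * Real.exp w.re < 1 := by
      rw [← Real.exp_log hA', ← Real.exp_add, Real.exp_lt_one_iff]
      linarith [hw.2]
    have hz : Tendsto (fun N : ℕ => K' * (A' * Real.exp w.re) ^ N) atTop (𝓝 0) := by
      simpa using (tendsto_pow_atTop_nhds_zero_of_lt_one (by positivity) hlt).const_mul K'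
    rw [tendsto_iff_norm_sub_tendsto_zero]
    refine squeeze_zero (fun _ => norm_nonneg _) (fun N => ?_) hz
    have := h₃ N w (logSector_subset d b hR₃ hw)
    rw [norm_sub_rev]
    refine this.trans_eq ?_
    -- The `1 / N!^s` in the remainders of `Γ` cancels the `N!^s` produced by the `s` transforms,
    -- leaving a geometric bound.
    rw [one_div, inv_mul_cancel₀ (by positivity), mul_one, mul_pow, Real.exp_nat_mul, mul_assoc]

/-! ### Asymptotic expansions and differential operators -/

/-- `F` is holomorphic on a sector and has there the Poincaré asymptotic expansion `f`. -/
def HasAsymptotics (d b R : ℝ) (f : ℂ⟦X⟧) (F : ℂ → ℂ) : Prop :=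
  DifferentiableOn ℂ F (logSector d b R) ∧ ∀ b' < b, ∀ R' < R, ∀ N : ℕ, ∃ K : ℝ, ∀ w : ℂ,
    |w.im - d| ≤ b' → w.re ≤ R' →
      ‖F w - ∑ p ∈ Finset.range N, PowerSeries.coeff p f * cexp w ^ p‖ ≤ K * Real.exp (N * w.re)

section Asymptotics

variable {d b R : ℝ} {f g : ℂ⟦X⟧} {F G : ℂ → ℂ}

theorem HasAsymptotics.add (hF : HasAsymptotics d b R f F) (hG : HasAsymptotics d b R g G) :
    HasAsymptotics d b R (f + g) (fun w => F w + G w) := by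
  refine ⟨hF.1.add hG.1, fun b' hb R' hR N => ?_⟩
  obtain ⟨K, hK⟩ := hF.2 b' hb R' hR N
  obtain ⟨L, hL⟩ := hG.2 b' hb R' hR N
  refine ⟨K + L, fun w h1 h2 => ?_⟩
  simp only [map_add, add_mul, Finset.sum_add_distrib]
  rw [add_sub_add_comm]
  exact (norm_add_le _ _).trans (add_le_add (hK w h1 h2) (hL w h1 h2))

theorem HasAsymptotics.smul (hF : HasAsymptotics d b R f F) (c : ℂ) :
    HasAsymptotics d b R (c • f) (fun w => c * F w) := by
  refine ⟨hF.1.const_mul c, fun b' hb R' hR N => ?_⟩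
  obtain ⟨K, hK⟩ := hF.2 b' hb R' hR N
  refine ⟨‖c‖ * K, fun w h1 h2 => ?_⟩
  simp only [map_smul, smul_eq_mul, mul_assoc, ← Finset.mul_sum]
  rw [← mul_sub, norm_mul]
  exact mul_le_mul_of_nonneg_left (hK w h1 h2) (norm_nonneg c)

theorem HasAsymptotics.sum {ι : Type*} (S : Finset ι) {f : ι → ℂ⟦X⟧} {F : ι → ℂ → ℂ}
    (h : ∀ i ∈ S, HasAsymptotics d b R (f i) (F i)) :
    HasAsymptotics d b R (∑ i ∈ S, f i) (fun w => ∑ i ∈ S, F i w) := by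
  classical
  induction S using Finset.induction_on with
  | empty => exact ⟨by simp, fun _ _ _ _ _ => ⟨0, by simp⟩⟩
  | insert i S hi ih =>
    simp only [Finset.sum_insert hi]
    exact (h i (Finset.mem_insert_self i S)).add
      (ih fun j hj => h j (Finset.mem_insert_of_mem hj))

theorem HasAsymptotics.exp_mul (hF : HasAsymptotics d b R f F) :
    HasAsymptotics d b R (PowerSeries.X * f) (fun w => cexp w * F w) := by
  refine ⟨Complex.differentiable_exp.differentiableOn.mul hF.1, fun b' hb R' hR N => ?_⟩
  cases N with
  | zero =>
    obtain ⟨K, hK⟩ := hF.2 b' hb R' hR 0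
    refine ⟨Real.exp R' * K, fun w h1 h2 => ?_⟩
    have := hK w h1 h2
    simp only [Finset.range_zero, Finset.sum_empty, sub_zero, Nat.cast_zero, zero_mul,
      Real.exp_zero, mul_one] at this ⊢
    rw [norm_mul, Complex.norm_exp]
    gcongr
  | succ N =>
    obtain ⟨K, hK⟩ := hF.2 b' hb R' hR N
    refine ⟨K, fun w h1 h2 => ?_⟩
    have e : cexp w * F w - ∑ p ∈ Finset.range (N + 1),
        PowerSeries.coeff p (PowerSeries.X * f) * cexp w ^ p =
        cexp w * (F w - ∑ p ∈ Finset.range N, PowerSeries.coeff p f * cexp w ^ p) := by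
      rw [Finset.sum_range_succ', PowerSeries.coeff_zero_X_mul, zero_mul, add_zero, mul_sub,
        Finset.mul_sum]
      congr 1
      refine Finset.sum_congr rfl fun p _ => ?_
      rw [PowerSeries.coeff_succ_X_mul]; ring
    rw [e, norm_mul, Complex.norm_exp]
    refine (mul_le_mul_of_nonneg_left (hK w h1 h2) (Real.exp_pos _).le).trans_eq ?_
    rw [mul_left_comm, ← Real.exp_add]
    push_cast; ring_nf

/-- Cauchy's estimate for the remainder on a disc of fixed radius `ε` in the logarithmic chart. On
it `|z|` varies by at most the factor `e^ε`, so the order `|z|^N` survives. -/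
theorem HasAsymptotics.deriv (hF : HasAsymptotics d b R f F) :
    HasAsymptotics d b R (PowerSeries.X * PowerSeries.derivative ℂ f) (deriv F) := by
  refine ⟨hF.1.deriv (isOpen_logSector d b R), fun b' hb R' hR N => ?_⟩
  obtain ⟨ε, hε, hε1⟩ : ∃ ε > 0, ε < min (b - b') (R - R') :=
    exists_between (lt_min (by linarith) (by linarith))
  have hε2 := hε1.trans_le (min_le_left _ _)
  have hε3 := hε1.trans_le (min_le_right _ _)
  obtain ⟨K, hK⟩ := hF.2 (b' + ε) (by linarith) (R' + ε) (by linarith) N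
  refine ⟨|K| * Real.exp (N * ε) / ε, fun w h1 h2 => ?_⟩
  have hsub : ∀ v ∈ Metric.closedBall w ε, v ∈ logSector d b R := fun v hv => by
    obtain ⟨h3, h4⟩ := im_re_le_of_mem_closedBall h1 hv
    exact ⟨by linarith, by linarith⟩
  have hmono : DifferentiableOn ℂ (fun w => ∑ p ∈ Finset.range N,
      PowerSeries.coeff p f * cexp w ^ p) (logSector d b R) :=
    Differentiable.differentiableOn (by fun_prop)
  have key : ‖_root_.deriv (fun w => F w - ∑ p ∈ Finset.range N,
      PowerSeries.coeff p f * cexp w ^ p) w‖ ≤ |K| * Real.exp (N * (w.re + ε)) / ε := by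
    refine Complex.norm_deriv_le_of_forall_mem_sphere_norm_le hε
      ((hF.1.sub hmono).diffContOnCl_ball hsub) fun v hv => ?_
    obtain ⟨h3, h4⟩ := im_re_le_of_mem_closedBall h1 (Metric.sphere_subset_closedBall hv)
    refine (hK v h3 (by linarith)).trans ?_
    gcongr
    exact le_abs_self K
  have hw := hsub w (Metric.mem_closedBall_self hε.le)
  have hd : _root_.deriv (fun w => F w - ∑ p ∈ Finset.range N,
      PowerSeries.coeff p f * cexp w ^ p) w = _root_.deriv F w - ∑ p ∈ Finset.range N,
      PowerSeries.coeff p (PowerSeries.X * PowerSeries.derivative ℂ f) * cexp w ^ p := by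
    have hF' := (hF.1.differentiableAt ((isOpen_logSector d b R).mem_nhds hw)).hasDerivAt
    have hs : HasDerivAt (fun w => ∑ p ∈ Finset.range N, PowerSeries.coeff p f * cexp w ^ p)
        (∑ p ∈ Finset.range N,
          PowerSeries.coeff p (PowerSeries.X * PowerSeries.derivative ℂ f) * cexp w ^ p) w := by
      refine HasDerivAt.fun_sum fun p _ => ?_
      refine (((Complex.hasDerivAt_exp w).pow p).const_mul _).congr_deriv ?_
      cases p with
      | zero => simp
      | succ p =>
        rw [PowerSeries.coeff_succ_X_mul, PowerSeries.coeff_derivative]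
        rw [Nat.cast_succ, Nat.add_sub_cancel, pow_succ]
        ring
    exact (hF'.sub hs).deriv
  rw [← hd]
  refine key.trans_eq ?_
  rw [mul_add, Real.exp_add]; ring

theorem HasAsymptotics.eulerAddOne (hF : HasAsymptotics d b R f F) :
    HasAsymptotics d b R ((LinearMap.mulLeft ℂ (PowerSeries.X : ℂ⟦X⟧) *
      (PowerSeries.derivative ℂ : Derivation ℂ ℂ⟦X⟧ ℂ⟦X⟧).toLinearMap + 1) f) (eulerAddOne F) := by
  rw [show GevreySum.eulerAddOne F = fun w => _root_.deriv F w + F w from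
    funext (eulerAddOne_apply F)]
  exact hF.deriv.add hF

theorem HasAsymptotics.diffOp (hF : HasAsymptotics d b R f F) (s : ℕ) :
    HasAsymptotics d b R (formalDiffOp s f) (diffOp s F) := by
  rw [formalDiffOp, Module.End.mul_apply]
  refine HasAsymptotics.exp_mul ?_
  induction s with
  | zero => exact hF
  | succ s ih =>
    rw [Function.iterate_succ_apply', pow_succ', Module.End.mul_apply]
    exact ih.eulerAddOne

theorem HasAsymptotics.polyDiffOp (hF : HasAsymptotics d b R f F) (s : ℕ) (P : Polynomial ℂ) :
    HasAsymptotics d b R (Polynomial.aeval (formalDiffOp s) P f) (polyDiffOp s P F) := by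
  have hi : ∀ n : ℕ, HasAsymptotics d b R ((formalDiffOp s ^ n) f)
      ((GevreySum.diffOp s)^[n] F) := by
    intro n
    induction n with
    | zero => exact hF
    | succ n ih =>
      rw [Function.iterate_succ_apply', pow_succ', Module.End.mul_apply]
      exact ih.diffOp s
  have e : Polynomial.aeval (formalDiffOp s) P f =
      ∑ n ∈ P.support, P.coeff n • (formalDiffOp s ^ n) f := by
    rw [Polynomial.aeval_def, Polynomial.eval₂_eq_sum, Polynomial.sum, LinearMap.sum_apply]
    rfl
  rw [e]
  exact HasAsymptotics.sum P.support fun n _ => (hi n).smul (P.coeff n)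

/-- Once the earlier coefficients agree, comparing remainders of order `N + 1` bounds the difference
of the `N`-th ones by a constant times `|z|`, which tends to zero along the ray. -/
theorem eq_of_asymptotics (h : ∀ N : ℕ, ∃ K R' : ℝ, ∀ t ≤ R',
      ‖F (t + d * I) - ∑ p ∈ Finset.range N, PowerSeries.coeff p f * cexp (t + d * I) ^ p‖ ≤
        K * Real.exp (N * t))
    (h' : ∀ N : ℕ, ∃ K R' : ℝ, ∀ t ≤ R',
      ‖F (t + d * I) - ∑ p ∈ Finset.range N, PowerSeries.coeff p g * cexp (t + d * I) ^ p‖ ≤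
        K * Real.exp (N * t)) : f = g := by
  ext N
  induction N using Nat.strong_induction_on with
  | _ N ih =>
    obtain ⟨K, R, hK⟩ := h (N + 1)
    obtain ⟨L, S, hL⟩ := h' (N + 1)
    have hlim : Tendsto (fun t : ℝ => (K + L) * Real.exp t) atBot (𝓝 0) := by
      simpa using Real.tendsto_exp_atBot.const_mul (K + L)
    have hle : ‖PowerSeries.coeff N f - PowerSeries.coeff N g‖ ≤ 0 := by
      refine ge_of_tendsto hlim ?_
      filter_upwards [eventually_le_atBot R, eventually_le_atBot S] with t ht1 ht2
      have h1 := hK t ht1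
      have h2 := hL t ht2
      rw [Finset.sum_range_succ] at h1 h2
      rw [Finset.sum_congr rfl fun p hp => by rw [ih p (Finset.mem_range.1 hp)]] at h1
      set z := cexp (t + d * I)
      set A := ∑ p ∈ Finset.range N, PowerSeries.coeff p g * z ^ p
      have e : (PowerSeries.coeff N f - PowerSeries.coeff N g) * z ^ N =
          (F (t + d * I) - (A + PowerSeries.coeff N g * z ^ N)) -
          (F (t + d * I) - (A + PowerSeries.coeff N f * z ^ N)) := by ring
      have h3 := (congrArg norm e).trans_le ((norm_sub_le _ _).trans (add_le_add h2 h1))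
      have hz : ‖z‖ = Real.exp t := by simp [z, Complex.norm_exp]
      rw [norm_mul, norm_pow, hz, ← Real.exp_nat_mul] at h3
      have h4 : Real.exp ((N + 1 : ℕ) * t) = Real.exp t * Real.exp (N * t) := by
        rw [← Real.exp_add]; push_cast; ring_nf
      rw [h4] at h3
      have hpos := Real.exp_pos (N * t)
      rw [← mul_le_mul_iff_left₀ hpos]
      linarith
    exact sub_eq_zero.1 (norm_le_zero_iff.1 hle)

end Asymptotics

theorem IsKSum.hasAsymptotics {k : ℝ} {f : ℂ⟦X⟧} {d b R : ℝ} {F : ℂ → ℂ} (hb : 0 < b)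
    (h : IsKSum k f d (2 * b / Real.pi) (Real.exp R) F) : HasAsymptotics d b R f F := by
  refine ⟨sector_eq_logSector d b R ▸ h.holomorphic, fun b' hb' R' hR' N => ?_⟩
  obtain ⟨b₁, hb₁, hb₂, hb₃⟩ := exists_between_angle hb hb'
  obtain ⟨R₁, hR₁, hR₂⟩ := exists_between hR'
  obtain ⟨C, A, -, -, hCA⟩ := h.expansion d (2 * b₁ / Real.pi) (Real.exp R₁)
    (by positivity) (Real.exp_pos _) (by
      rw [sector_eq_logSector, sector_eq_logSector]
      have hcl : IsClosed {w : ℂ | |w.im - d| ≤ b₁ ∧ w.re ≤ R₁} :=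
        (isClosed_le (continuous_im.sub continuous_const).abs continuous_const).inter
          (isClosed_le continuous_re continuous_const)
      have hsub : logSector d b₁ R₁ ⊆ {w : ℂ | |w.im - d| ≤ b₁ ∧ w.re ≤ R₁} :=
        fun w hw => ⟨hw.1.le, hw.2.le⟩
      exact (closure_minimal hsub hcl).trans fun w hw =>
        ⟨lt_of_le_of_lt hw.1 hb₃, lt_of_le_of_lt hw.2 hR₂⟩)
  refine ⟨C * A ^ N * (N ! : ℝ) ^ (1 / k), fun w h1 h2 => ?_⟩
  have := hCA N w (by
    rw [sector_eq_logSector]; exact ⟨by linarith, by linarith⟩)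
  rwa [LogSurface.abs, ← Real.exp_nat_mul] at this

theorem exists_isNonsingularDirection {P : Polynomial ℂ} (hP : P ≠ 0) :
    ∃ d : ℝ, IsNonsingularDirection P d := by
  classical
  -- Choosing `d` in `(-π, π]` makes equality with an argument modulo `2π` an actual equality,
  -- excluded for all of the finitely many roots.
  obtain ⟨d, hd, hdn⟩ := (Set.Ioc_infinite (show -Real.pi < Real.pi by
    linarith [Real.pi_pos])).exists_notMem_finset (P.roots.toFinset.image Complex.arg)
  refine ⟨d, fun z hz h => hdn (Finset.mem_image.2 ⟨z, ?_, ?_⟩)⟩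
  · rwa [Multiset.mem_toFinset, Polynomial.mem_roots hP]
  · have := congrArg Real.Angle.toReal h
    rwa [Complex.arg_coe_angle_toReal_eq_arg, Real.Angle.toReal_coe_eq_self_iff_mem_Ioc.2 hd] at this

theorem isFormalSolution_of_summableToSolution {s : ℕ} {k : ℝ} (hk : (s : ℝ) = 1 / k) {f : ℂ⟦X⟧}
    (h : SummableToSolution k s f) : IsFormalSolution s f := by
  obtain ⟨r, a, P, g, -, hP, hg, hd⟩ := h
  obtain ⟨d, hdn⟩ := exists_isNonsingularDirection (P := recPoly r a) (fun h0 => by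
    have := coeff_recPoly r a 0
    simp [h0] at this)
  obtain ⟨θ, ρ, F, hF, hsol⟩ := hd d hdn
  have hθ : 0 < θ := lt_of_le_of_lt (hk ▸ Nat.cast_nonneg s) hF.opening
  have hpi := Real.pi_pos
  obtain ⟨b, hb, rfl⟩ : ∃ b > 0, θ = 2 * b / Real.pi :=
    ⟨Real.pi * θ / 2, by positivity, by field_simp⟩
  obtain ⟨R, rfl⟩ : ∃ R, ρ = Real.exp R := ⟨Real.log ρ, (Real.exp_log hF.radius_pos).symm⟩
  have hA := (hF.hasAsymptotics hb).polyDiffOp s P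
  refine ⟨P, g, hP, hg, eq_of_asymptotics (d := d) (F := polyDiffOp s P F) (fun N => ?_)
    fun N => ?_⟩
  · obtain ⟨K, hK⟩ := hA.2 0 hb (R - 1) (by linarith) N
    exact ⟨K, R - 1, fun t ht => by simpa using hK (t + d * I) (by simp) (by simpa using ht)⟩
  · obtain ⟨C, M, hC, hM, hgb⟩ := (isConvergent_iff g).1 hg
    -- For `M |z| ≤ 1/2` the geometric tail of `g` from index `N` on is at most `2 C (M |z|)^N`.
    refine ⟨2 * C * M ^ N, min (R - 1) (-Real.log (2 * M)), fun t ht => ?_⟩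
    have h1 : t ≤ R - 1 := ht.trans (min_le_left _ _)
    have h2 : t ≤ -Real.log (2 * M) := ht.trans (min_le_right _ _)
    have hs := hsol (t + d * I) (by
      rw [sector_eq_logSector]
      exact ⟨by simpa using hb, by simp; linarith⟩)
    have hq : M * Real.exp t ≤ 1 / 2 := by
      have : Real.exp t ≤ (2 * M)⁻¹ := by
        rw [← Real.log_inv] at h2
        exact (Real.le_log_iff_exp_le (by positivity)).1 h2
      calc M * Real.exp t ≤ M * (2 * M)⁻¹ := by gcongr
        _ = 1 / 2 := by field_simp
    have hterm : ∀ n : ℕ, ‖PowerSeries.coeff n g * (LogSurface.proj (t + d * I)) ^ n‖ ≤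
        C * (M * Real.exp t) ^ n := by
      intro n
      rw [norm_mul, norm_pow, LogSurface.proj, Complex.norm_exp, mul_pow, ← mul_assoc]
      simp only [add_re, ofReal_re, mul_re, I_re, mul_zero, ofReal_im, I_im, mul_one, sub_self,
        add_zero]
      gcongr
      exact hgb n
    have := norm_sub_le_of_geometric_bound_of_hasSum (by linarith) hterm hs N
    rw [norm_sub_rev] at this
    refine this.trans ?_
    rw [div_le_iff₀ (by linarith), mul_pow, ← Real.exp_nat_mul]
    have hpos : 0 < C * M ^ N * Real.exp (N * t) := by positivity
    nlinarith

end GevreySum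

/-! ### The equivalence -/

theorem mainTheorem4 (s : ℕ) (k : ℝ) (hs : 1 ≤ s) (hk : (s : ℝ) = 1 / k)
    (f : PowerSeries ℂ) (hf : PowerSeries.coeff 0 f = 0) :
    List.TFAE [GevreySum.IsFormalSolution s f,
      GevreySum.RecurrenceEstimate s f,
      GevreySum.SummableToSolution k s f] := by
  tfae_have 1 → 2 := GevreySum.recurrenceEstimate_of_isFormalSolution
  tfae_have 2 → 1 := GevreySum.isFormalSolution_of_recurrenceEstimate
  tfae_have 1 → 3 := GevreySum.summableToSolution_of_isFormalSolution hs hk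
  tfae_have 3 → 1 := GevreySum.isFormalSolution_of_summableToSolution hk
  tfae_finish
end
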